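/- Let $\theta>0$. Let $y=(y_j)_{j\ge 1}$ be a random sequence with the $\mathrm{GEM}(\theta)$ distribution, i.e. with the law of $\bigl(V_j\prod_{i<j}(1-V_i)\bigr)_{j\ge1}$, where $V_1,V_2,\dots$ are i.i.d. $\mathrm{Beta}(1,\theta)$ random variables. Let $(\Phi_j)_{j\ge 1}$ be i.i.d. random variables uniformly distributed on $[0,1)$, independent of $y$. Let $$\widetilde{\tau}_\infty := \sum_{j=1}^{\infty}\sum_{k\in\mathbb Z}\delta_{(k+\Phi_j)/y_j}$$ (the limiting point process of the rescaled eigenangles of Ewens($\theta$) permutation matrices whose unit entries are replaced by i.i.d. uniform phases). Then, almost surely, $\widetilde{\tau}_\infty([0,A])<\infty$ for all real $A$, and, as $A\to+\infty$, $$\frac{\widetilde{\tau}_\infty([0,A])-A}{\sqrt{\frac{\theta}{6}\log A}}\ \longrightarrow\ \mathcal N(0,1)\quad\text{in distribution.}$$ -/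

import Mathlib

open MeasureTheory ProbabilityTheory Filter Set

/-- Stick breaking (residual allocation): from fractions `v 0, v 1, …` of a stick of length one,
the `j`-th piece is `v j * ∏ i < j, (1 - v i)`. Indices start at `0`. -/
noncomputable def stickBreaking (v : ℕ → ℝ) : ℕ → ℝ :=
  fun j => v j * ∏ i ∈ Finset.range j, (1 - v i)

theorem measurable_stickBreaking : Measurable stickBreaking := by
  unfold stickBreaking
  fun_prop

/-- The GEM(`θ`) distribution, for `θ > 0`: the law of the stick breaking sequence whose fractions
are i.i.d. with Beta(`1`, `θ`) distribution. -/
noncomputable def gemMeasure (θ : ℝ) : Measure (ℕ → ℝ) :=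
  (Measure.infinitePi fun _ : ℕ => betaMeasure 1 θ).map stickBreaking

theorem isProbabilityMeasure_gemMeasure {θ : ℝ} (hθ : 0 < θ) :
    IsProbabilityMeasure (gemMeasure θ) := by
  have : IsProbabilityMeasure (betaMeasure 1 θ) := isProbabilityMeasureBeta one_pos hθ
  exact Measure.isProbabilityMeasure_map measurable_stickBreaking.aemeasurable

/-- The point measure `∑ j, ∑ k ∈ ℤ, δ_{(k + φ j) / y j}` on the real line (points are counted
with multiplicity). For random `y` and `φ`, with `y` of law GEM(`θ`) and independent of `φ`, and
`φ` i.i.d. uniform on `[0, 1)`, this is the limiting point process of the rescaled eigenangles of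
Ewens(`θ`) permutation matrices with i.i.d. uniform phases. -/
noncomputable def eigenanglePointMeasure (y φ : ℕ → ℝ) : Measure ℝ :=
  Measure.sum fun j : ℕ => Measure.sum fun k : ℤ => Measure.dirac (((k : ℝ) + φ j) / y j)

open scoped Topology

/-! Fix the pieces `y`. In `[0, A]` the `j`-th coset contributes `A * y j` points plus a centred
Bernoulli variable whose parameter is the fractional part of `A * y j` (`floor_sub_add_one`). Since
the pieces sum to `1`, the count minus `A` is a sum of independent centred Bernoulli variables with
total variance `V = ∑' j, fractVar (A * y j)`. A Lindeberg comparison puts its characteristic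
function at `s` within `2 * |s| ^ 3 * V` of `exp (-s ^ 2 * V / 2)` (`norm_integral_exp_sub_le`). It
therefore suffices that `V / log A` tends to `θ / 6` in probability.

By the law of large numbers for `-log (1 - v i)`, whose mean is `1 / θ`, the stick remaining after
`n` steps is roughly `exp (-n / θ)`. So about `θ * log A` pieces are broken off while `A` times the
remaining stick is still large. Given the past, such a piece contributes to `V` a mean close to `1 /
6`, by the Riemann–Lebesgue lemma applied to the Fourier series of `fractVar`
(`tendsto_integral_fractVar_betaMeasure`). The later pieces contribute `o(log A)`
(`tendsto_stickVar_sub_div`). The deviations from the conditional means form a martingale with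
increments bounded by `1`, so its second moment after `n` steps is at most `n`, negligible against
`(log A) ^ 2` (`integral_stickMartingale_sq_le`).

Convergence in probability becomes almost sure along subsequences; dominated convergence over the
fractions and Lévy's continuity theorem conclude. -/

/-! ### The Beta(1, θ) law and its logarithmic moment. -/

theorem betaPDFReal_one_of_mem {θ x : ℝ} (hθ : 0 < θ) (hx : x ∈ Ioo (0 : ℝ) 1) :
    betaPDFReal 1 θ x = θ * (1 - x) ^ (θ - 1) := by
  have hG := (Real.Gamma_pos_of_pos hθ).ne'
  rw [betaPDFReal, if_pos (show 0 < x ∧ x < 1 from hx), beta, Real.Gamma_one,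
    add_comm, Real.Gamma_add_one hθ.ne']
  simp only [sub_self, Real.rpow_zero]
  field_simp

theorem betaPDFReal_nonneg {a b : ℝ} (ha : 0 < a) (hb : 0 < b) (x : ℝ) : 0 ≤ betaPDFReal a b x := by
  by_cases hx : 0 < x ∧ x < 1
  · exact (betaPDFReal_pos hx.1 hx.2 ha hb).le
  · rw [betaPDFReal, if_neg hx]

theorem ae_betaMeasure_mem_Ioo (a b : ℝ) : ∀ᵐ x ∂betaMeasure a b, x ∈ Ioo (0 : ℝ) 1 := by
  rw [betaMeasure, ae_withDensity_iff (by unfold betaPDF; fun_prop)]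
  refine ae_of_all _ fun x hx => ?_
  by_contra h
  exact hx (by rw [betaPDF, betaPDFReal, if_neg (show ¬(0 < x ∧ x < 1) from h),
    ENNReal.ofReal_zero])

theorem integral_betaMeasure {a b : ℝ} (ha : 0 < a) (hb : 0 < b) {E : Type*} [NormedAddCommGroup E]
    [NormedSpace ℝ E] (f : ℝ → E) :
    ∫ x, f x ∂betaMeasure a b = ∫ x, betaPDFReal a b x • f x := by
  rw [betaMeasure, integral_withDensity_eq_integral_toReal_smul (by unfold betaPDF; fun_prop)
    (ae_of_all _ fun x => by simp [betaPDF])]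
  simp_rw [betaPDF, ENNReal.toReal_ofReal (betaPDFReal_nonneg ha hb _)]

theorem integrable_betaMeasure_iff {a b : ℝ} (ha : 0 < a) (hb : 0 < b) {f : ℝ → ℝ} :
    Integrable f (betaMeasure a b) ↔ Integrable (fun x => betaPDFReal a b x * f x) := by
  rw [betaMeasure, integrable_withDensity_iff_integrable_smul' (by unfold betaPDF; fun_prop)
    (ae_of_all _ fun x => by simp [betaPDF])]
  simp_rw [betaPDF, ENNReal.toReal_ofReal (betaPDFReal_nonneg ha hb _), smul_eq_mul]

theorem continuousOn_rpow_mul_log {θ : ℝ} (hθ : 0 < θ) :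
    ContinuousOn (fun u : ℝ => u ^ θ * Real.log u) (Ici 0) := by
  intro u hu
  rcases (mem_Ici.1 hu).eq_or_lt with rfl | h
  · have h := tendsto_log_mul_rpow_nhdsGT_zero hθ
    rw [← Ioi_insert, continuousWithinAt_insert_self]
    simpa [ContinuousWithinAt, mul_comm] using h
  · exact ((Real.continuousAt_rpow_const _ _ (Or.inl h.ne')).mul
      (Real.continuousAt_log h.ne')).continuousWithinAt

theorem betaPDFReal_mul_eq_indicator {θ : ℝ} (hθ : 0 < θ) (f : ℝ → ℝ) :
    (fun x => betaPDFReal 1 θ x * f x) =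
      (Ioo (0 : ℝ) 1).indicator fun x => θ * (1 - x) ^ (θ - 1) * f x := by
  ext x
  by_cases hx : x ∈ Ioo (0 : ℝ) 1
  · rw [indicator_of_mem hx, betaPDFReal_one_of_mem hθ hx]
  · rw [indicator_of_notMem hx, betaPDFReal, if_neg (show ¬(0 < x ∧ x < 1) from hx), zero_mul]

/-- Integration by parts supplies this antiderivative. It extends continuously to `x = 1`, so the
fundamental theorem of calculus holds on all of `[0, 1]` even where the integrand blows up at `1`.
-/
theorem hasDerivAt_beta_log {θ x : ℝ} (hθ : 0 < θ) (hx : x ∈ Ioo (0 : ℝ) 1) :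
    HasDerivAt (fun x : ℝ => (1 - x) ^ θ * Real.log (1 - x) - (1 - x) ^ θ / θ)
      (θ * (1 - x) ^ (θ - 1) * -Real.log (1 - x)) x := by
  have h1 : 0 < 1 - x := by linarith [hx.2]
  have hd : HasDerivAt (fun x : ℝ => 1 - x) (-1) x := by
    simpa using (hasDerivAt_id x).const_sub 1
  have hp := hd.rpow_const (p := θ) (Or.inl h1.ne')
  have hl := hd.log h1.ne'
  convert! (hp.mul hl).sub (hp.div_const θ) using 1
  have : (1 - x) ^ θ = (1 - x) ^ (θ - 1) * (1 - x) := by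
    rw [← Real.rpow_add_one h1.ne']; ring_nf
  rw [this]
  field_simp
  ring

theorem continuousOn_beta_log {θ : ℝ} (hθ : 0 < θ) :
    ContinuousOn (fun x : ℝ => (1 - x) ^ θ * Real.log (1 - x) - (1 - x) ^ θ / θ) (Icc 0 1) := by
  refine ContinuousOn.sub ?_ ?_
  · exact (continuousOn_rpow_mul_log hθ).comp (f := fun x : ℝ => 1 - x) (by fun_prop)
      fun x hx => by simpa using hx.2
  · exact Continuous.continuousOn
      (((continuous_const.sub continuous_id).rpow_const fun _ => Or.inr hθ.le).div_const _)

theorem integrableOn_beta_log {θ : ℝ} (hθ : 0 < θ) :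
    IntegrableOn (fun x : ℝ => θ * (1 - x) ^ (θ - 1) * -Real.log (1 - x)) (Ioc 0 1) := by
  refine intervalIntegral.integrableOn_deriv_of_nonneg (continuousOn_beta_log hθ)
    (fun x hx => hasDerivAt_beta_log hθ hx) fun x hx => ?_
  have h1 : 0 < 1 - x := by linarith [hx.2]
  have : Real.log (1 - x) ≤ 0 := Real.log_nonpos h1.le (by linarith [hx.1])
  have : 0 ≤ -Real.log (1 - x) := by linarith
  positivity

theorem integrable_neg_log_one_sub_betaMeasure {θ : ℝ} (hθ : 0 < θ) :
    Integrable (fun x => -Real.log (1 - x)) (betaMeasure 1 θ) := by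
  rw [integrable_betaMeasure_iff one_pos hθ, betaPDFReal_mul_eq_indicator hθ,
    integrable_indicator_iff measurableSet_Ioo]
  exact (integrableOn_beta_log hθ).mono_set Ioo_subset_Ioc_self

theorem integral_neg_log_one_sub_betaMeasure {θ : ℝ} (hθ : 0 < θ) :
    ∫ x, -Real.log (1 - x) ∂betaMeasure 1 θ = θ⁻¹ := by
  rw [integral_betaMeasure one_pos hθ]
  simp_rw [smul_eq_mul]
  rw [betaPDFReal_mul_eq_indicator hθ, integral_indicator measurableSet_Ioo,
    ← integral_Ioc_eq_integral_Ioo, ← intervalIntegral.integral_of_le zero_le_one,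
    intervalIntegral.integral_eq_sub_of_hasDerivAt_of_le zero_le_one (continuousOn_beta_log hθ)
      (fun x hx => hasDerivAt_beta_log hθ hx)]
  · simp [Real.zero_rpow hθ.ne']
  · rw [intervalIntegrable_iff_integrableOn_Ioc_of_le zero_le_one]
    exact integrableOn_beta_log hθ

/-! ### The Bernoulli variance of a fractional part and its Beta average. -/

/-- The variance of a Bernoulli variable whose parameter is the fractional part of `x`. -/
noncomputable def fractVar (x : ℝ) : ℝ := Int.fract x * (1 - Int.fract x)

theorem measurable_fractVar : Measurable fractVar := by
  unfold fractVar
  exact measurable_fract.mul (measurable_const.sub measurable_fract)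

theorem fractVar_nonneg (x : ℝ) : 0 ≤ fractVar x :=
  mul_nonneg (Int.fract_nonneg x) (by linarith [Int.fract_lt_one x])

theorem fractVar_le_one (x : ℝ) : fractVar x ≤ 1 := by
  have := Int.fract_nonneg x
  have := Int.fract_lt_one x
  unfold fractVar
  nlinarith

theorem fractVar_le_self {x : ℝ} (hx : 0 ≤ x) : fractVar x ≤ x := by
  have h0 := Int.fract_nonneg x
  have h1 : Int.fract x ≤ x := by
    have : (0 : ℝ) ≤ ⌊x⌋ := by exact_mod_cast Int.floor_nonneg.2 hx
    linarith [Int.floor_add_fract x]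
  unfold fractVar
  nlinarith

theorem abs_fractVar_le_one (x : ℝ) : |fractVar x| ≤ 1 := by
  rw [abs_of_nonneg (fractVar_nonneg x)]
  exact fractVar_le_one x

/-- On fractional parts, `1 / 6 - fractVar` is the second Bernoulli polynomial, whose Fourier series
is classical. The term `n = 0` vanishes because `1 / 0 = 0`. -/
theorem hasSum_fractVar (x : ℝ) :
    HasSum (fun n : ℕ => 1 / (n : ℝ) ^ 2 * Real.cos (2 * Real.pi * n * x))
      (Real.pi ^ 2 * (1 / 6 - fractVar x)) := by
  have h := hasSum_one_div_nat_pow_mul_cos one_ne_zero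
    (x := Int.fract x) ⟨Int.fract_nonneg x, (Int.fract_lt_one x).le⟩
  have hb (t : ℝ) : ((Polynomial.bernoulli 2).map (algebraMap ℚ ℝ)).eval t = t ^ 2 - t + 1 / 6 := by
    simp [Polynomial.bernoulli, Finset.sum_range_succ, bernoulli, bernoulli'_two]
    ring
  convert h using 1
  · ext n
    congr 1
    have : 2 * Real.pi * n * x = 2 * Real.pi * n * Int.fract x +
        ((n * ⌊x⌋ : ℤ) : ℝ) * (2 * Real.pi) := by
      conv_lhs => rw [← Int.floor_add_fract x]
      push_cast; ring
    rw [this, Real.cos_add_int_mul_two_pi]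
  · rw [mul_one, hb]
    simp only [fractVar, mul_one, Nat.factorial]
    push_cast
    ring

/-- Riemann–Lebesgue for the Beta density, read off from the real part of its Fourier transform. -/
theorem tendsto_integral_cos_betaMeasure {θ : ℝ} (hθ : 0 < θ) :
    Tendsto (fun w : ℝ => ∫ x, Real.cos (2 * Real.pi * w * x) ∂betaMeasure 1 θ) atTop (𝓝 0) := by
  have h := (Real.tendsto_integral_exp_smul_cocompact fun x => (betaPDFReal 1 θ x : ℂ)).mono_left
    atTop_le_cocompact
  have h2 := (Complex.continuous_re.tendsto 0).comp h
  refine h2.congr fun w => ?_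
  have hp : IsProbabilityMeasure (betaMeasure 1 θ) := isProbabilityMeasureBeta one_pos hθ
  have key : ∫ v : ℝ, Real.fourierChar (-(v * w)) • (betaPDFReal 1 θ v : ℂ) =
      ∫ v, (Real.fourierChar (-(v * w)) : ℂ) ∂betaMeasure 1 θ := by
    rw [integral_betaMeasure one_pos hθ]
    congr 1; ext v
    rw [Circle.smul_def, smul_eq_mul, Complex.real_smul, mul_comm]
  simp only [Function.comp_apply]
  rw [key, ← RCLike.re_to_complex, ← integral_re]
  · congr 1; ext v
    rw [Real.fourierChar_apply, RCLike.re_to_complex, Complex.exp_ofReal_mul_I_re,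
      ← Real.cos_neg]
    ring_nf
  · refine Integrable.of_bound (C := 1) ?_ (ae_of_all _ fun v => (Circle.norm_coe _).le)
    exact Continuous.aestronglyMeasurable (by fun_prop)

/-- Every nonconstant harmonic of `fractVar` averages out as `r` grows, and the coefficients `1 / n
^ 2` dominate the series; only the constant term `1 / 6` survives. -/
theorem tendsto_integral_fractVar_betaMeasure {θ : ℝ} (hθ : 0 < θ) :
    Tendsto (fun r : ℝ => ∫ x, fractVar (r * x) ∂betaMeasure 1 θ) atTop (𝓝 (1 / 6)) := by
  have hp : IsProbabilityMeasure (betaMeasure 1 θ) := isProbabilityMeasureBeta one_pos hθ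
  have hsum : Summable fun n : ℕ => 1 / (n : ℝ) ^ 2 := Real.summable_one_div_nat_pow.2 one_lt_two
  have hbd : ∀ (n : ℕ) (z : ℝ), ‖1 / (n : ℝ) ^ 2 * Real.cos z‖ ≤ 1 / (n : ℝ) ^ 2 := fun n z => by
    rw [norm_mul, Real.norm_of_nonneg (by positivity)]
    exact mul_le_of_le_one_right (by positivity) (Real.abs_cos_le_one _)
  have hint : ∀ (r : ℝ) (n : ℕ), Integrable
      (fun x => 1 / (n : ℝ) ^ 2 * Real.cos (2 * Real.pi * n * (r * x))) (betaMeasure 1 θ) :=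
    fun r n => Integrable.of_bound (Continuous.aestronglyMeasurable (by fun_prop)) _
      (ae_of_all _ fun x => hbd n _)
  have key : ∀ r : ℝ, ∫ x, fractVar (r * x) ∂betaMeasure 1 θ = 1 / 6 - 1 / Real.pi ^ 2 *
      ∑' n : ℕ, 1 / (n : ℝ) ^ 2 * ∫ x, Real.cos (2 * Real.pi * (n * r) * x) ∂betaMeasure 1 θ := by
    intro r
    have h1 := hasSum_integral_of_summable_integral_norm (hint r)
      (Summable.of_nonneg_of_le (fun n => integral_nonneg fun x => norm_nonneg _)
        (fun n => (integral_mono_of_nonneg (ae_of_all _ fun x => norm_nonneg _)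
          (integrable_const _) (ae_of_all _ fun x => hbd n _)).trans (by simp)) hsum)
    simp_rw [fun x => (hasSum_fractVar (r * x)).tsum_eq, integral_const_mul] at h1
    have h2 : ∫ x, (1 / 6 - fractVar (r * x)) ∂betaMeasure 1 θ =
        1 / 6 - ∫ x, fractVar (r * x) ∂betaMeasure 1 θ := by
      rw [integral_sub (integrable_const _)]
      · simp
      · exact Integrable.of_bound (measurable_fractVar.comp (by fun_prop)).aestronglyMeasurable 1
          (ae_of_all _ fun x => abs_fractVar_le_one _)
    rw [h2] at h1
    have h3 : ∀ n : ℕ, ∀ x : ℝ, 2 * Real.pi * (n * r) * x = 2 * Real.pi * n * (r * x) :=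
      fun n x => by ring
    simp_rw [h3, h1.tsum_eq]
    field_simp
    ring
  simp_rw [key]
  have hlim : Tendsto (fun r : ℝ => ∑' n : ℕ, 1 / (n : ℝ) ^ 2 *
      ∫ x, Real.cos (2 * Real.pi * (n * r) * x) ∂betaMeasure 1 θ) atTop (𝓝 (∑' _ : ℕ, 0)) := by
    refine tendsto_tsum_of_dominated_convergence hsum (fun n => ?_) (Eventually.of_forall ?_)
    · rcases Nat.eq_zero_or_pos n with rfl | hn
      · simp
      · have := ((tendsto_integral_cos_betaMeasure hθ).comp
          (tendsto_id.const_mul_atTop (Nat.cast_pos.2 hn : (0 : ℝ) < n))).const_mul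
            (1 / (n : ℝ) ^ 2)
        simpa [Function.comp_def] using this
    · intro r n
      rw [norm_mul, Real.norm_of_nonneg (by positivity)]
      refine mul_le_of_le_one_right (by positivity) ?_
      refine (norm_integral_le_of_norm_le_const (C := 1) (ae_of_all _ fun x => ?_)).trans (by simp)
      exact Real.abs_cos_le_one _
  have h := (hlim.const_mul (1 / Real.pi ^ 2)).const_sub (1 / 6)
  rwa [tsum_zero, mul_zero, sub_zero] at h

/-! ### Exponential decay of the remaining stick. -/

/-- The part of the stick that remains after `n` pieces have been broken off. -/
noncomputable def stickRest (v : ℕ → ℝ) (n : ℕ) : ℝ := ∏ i ∈ Finset.range n, (1 - v i)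

theorem stickBreaking_apply (v : ℕ → ℝ) (j : ℕ) : stickBreaking v j = v j * stickRest v j := rfl

theorem measurable_stickRest (n : ℕ) : Measurable fun v => stickRest v n := by
  unfold stickRest
  fun_prop

theorem sum_stickBreaking (v : ℕ → ℝ) (n : ℕ) :
    ∑ j ∈ Finset.range n, stickBreaking v j = 1 - stickRest v n := by
  induction n with
  | zero => simp [stickRest]
  | succ n ih =>
    rw [Finset.sum_range_succ, ih, stickBreaking_apply, stickRest, stickRest,
      Finset.prod_range_succ]
    ring

/-- Stick breaking fractions in `(0, 1)` along which the logarithm of the remaining stick satisfies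
the law of large numbers. -/
structure IsRegularFractions (θ : ℝ) (v : ℕ → ℝ) : Prop where
  mem : ∀ i, v i ∈ Ioo (0 : ℝ) 1
  tendsto : Tendsto (fun n : ℕ => (∑ i ∈ Finset.range n, -Real.log (1 - v i)) / n) atTop (𝓝 θ⁻¹)

theorem ae_isRegularFractions {θ : ℝ} (hθ : 0 < θ) :
    ∀ᵐ v ∂Measure.infinitePi fun _ : ℕ => betaMeasure 1 θ, IsRegularFractions θ v := by
  have hp : IsProbabilityMeasure (betaMeasure 1 θ) := isProbabilityMeasureBeta one_pos hθ
  have hmp (i : ℕ) := measurePreserving_eval_infinitePi (fun _ : ℕ => betaMeasure 1 θ) i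
  have h1 : ∀ᵐ v ∂Measure.infinitePi fun _ : ℕ => betaMeasure 1 θ, ∀ i, v i ∈ Ioo (0 : ℝ) 1 :=
    ae_all_iff.2 fun i => (hmp i).quasiMeasurePreserving.ae (ae_betaMeasure_mem_Ioo 1 θ)
  have hm : Measurable fun x : ℝ => -Real.log (1 - x) := by fun_prop
  have hind : iIndepFun (fun (i : ℕ) (v : ℕ → ℝ) => -Real.log (1 - v i))
      (Measure.infinitePi fun _ : ℕ => betaMeasure 1 θ) :=
    iIndepFun_infinitePi (X := fun _ x => -Real.log (1 - x)) fun _ => hm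
  have h2 := strong_law_ae_real (fun (i : ℕ) (v : ℕ → ℝ) => -Real.log (1 - v i))
    ((hmp 0).integrable_comp_of_integrable (integrable_neg_log_one_sub_betaMeasure hθ))
    (fun i j hij => hind.indepFun hij) (fun i => ?_)
  · have h3 : ∫ v : ℕ → ℝ, -Real.log (1 - v 0) ∂(Measure.infinitePi fun _ : ℕ => betaMeasure 1 θ) =
        θ⁻¹ := by
      have h := integral_map (hmp 0).measurable.aemeasurable
        (hm.aestronglyMeasurable (μ := (Measure.infinitePi fun _ : ℕ => betaMeasure 1 θ).map
          (Function.eval 0)))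
      rw [(hmp 0).map_eq, integral_neg_log_one_sub_betaMeasure hθ] at h
      exact h.symm
    rw [h3] at h2
    filter_upwards [h1, h2] with v hv1 hv2 using ⟨hv1, hv2⟩
  · have : IdentDistrib (fun v : ℕ → ℝ => v i) (fun v => v 0)
        (Measure.infinitePi fun _ : ℕ => betaMeasure 1 θ)
        (Measure.infinitePi fun _ : ℕ => betaMeasure 1 θ) :=
      ⟨(hmp i).measurable.aemeasurable, (hmp 0).measurable.aemeasurable,
        (hmp i).map_eq.trans (hmp 0).map_eq.symm⟩
    exact this.comp hm

namespace IsRegularFractions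

variable {θ : ℝ} {v : ℕ → ℝ}

theorem stickRest_eq (hv : IsRegularFractions θ v) (n : ℕ) :
    stickRest v n = Real.exp (-∑ i ∈ Finset.range n, -Real.log (1 - v i)) := by
  rw [Finset.sum_neg_distrib, neg_neg, Real.exp_sum, stickRest]
  exact Finset.prod_congr rfl fun i _ => (Real.exp_log (by linarith [(hv.mem i).2])).symm

theorem stickRest_pos (hv : IsRegularFractions θ v) (n : ℕ) : 0 < stickRest v n := by
  rw [hv.stickRest_eq]
  exact Real.exp_pos _

theorem antitone_stickRest (hv : IsRegularFractions θ v) : Antitone (stickRest v) := by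
  refine antitone_nat_of_succ_le fun n => ?_
  rw [stickRest, Finset.prod_range_succ]
  exact mul_le_of_le_one_right (hv.stickRest_pos n).le (by linarith [(hv.mem n).1])

theorem stickBreaking_pos (hv : IsRegularFractions θ v) (j : ℕ) : 0 < stickBreaking v j :=
  mul_pos (hv.mem j).1 (hv.stickRest_pos j)

/-- The logarithm of `A` times the remaining stick after about `c * log A` steps. -/
theorem tendsto_sum_floor_div (hv : IsRegularFractions θ v) {c : ℝ} (hc : 0 < c) :
    Tendsto (fun L : ℝ => (∑ i ∈ Finset.range ⌊c * L⌋₊, -Real.log (1 - v i)) / L) atTop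
      (𝓝 (θ⁻¹ * c)) := by
  have hfl : Tendsto (fun L : ℝ => ⌊c * L⌋₊) atTop atTop :=
    tendsto_nat_floor_atTop.comp (tendsto_id.const_mul_atTop hc)
  refine ((hv.tendsto.comp hfl).mul (tendsto_nat_floor_mul_div_atTop hc.le)).congr' ?_
  filter_upwards [hfl.eventually_ge_atTop 1] with L hL
  have : ((⌊c * L⌋₊ : ℕ) : ℝ) ≠ 0 := by positivity
  simp only [Function.comp_apply]
  field_simp

/-- For `n` about `c * log A` the last factor tends to `1 - c / θ`, whose sign decides between
explosion and decay. The threshold is `c = θ`. -/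
theorem mul_stickRest_eq (hv : IsRegularFractions θ v) {A : ℝ} (hA : 1 < A) (n : ℕ) :
    A * stickRest v n = Real.exp
      (Real.log A * (1 - (∑ i ∈ Finset.range n, -Real.log (1 - v i)) / Real.log A)) := by
  have hL := Real.log_pos hA
  rw [mul_sub, mul_div_cancel₀ _ hL.ne', mul_one, sub_eq_add_neg, Real.exp_add,
    Real.exp_log (by linarith), hv.stickRest_eq]

theorem tendsto_mul_stickRest_atTop (hv : IsRegularFractions θ v) (hθ : 0 < θ) {c : ℝ}
    (hc : 0 < c) (hcθ : c < θ) :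
    Tendsto (fun A : ℝ => A * stickRest v ⌊c * Real.log A⌋₊) atTop atTop := by
  have h : 0 < 1 - θ⁻¹ * c := by
    rw [inv_mul_eq_div, sub_pos, div_lt_one hθ]; exact hcθ
  refine (Real.tendsto_exp_atTop.comp (Real.tendsto_log_atTop.atTop_mul_pos h
    (((hv.tendsto_sum_floor_div hc).comp Real.tendsto_log_atTop).const_sub 1))).congr' ?_
  filter_upwards [eventually_gt_atTop 1] with A hA
  exact (hv.mul_stickRest_eq hA _).symm

theorem tendsto_mul_stickRest_zero (hv : IsRegularFractions θ v) (hθ : 0 < θ) {c : ℝ}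
    (hcθ : θ < c) :
    Tendsto (fun A : ℝ => A * stickRest v ⌊c * Real.log A⌋₊) atTop (𝓝 0) := by
  have h : 1 - θ⁻¹ * c < 0 := by
    rw [inv_mul_eq_div, sub_neg, one_lt_div hθ]; exact hcθ
  refine (Real.tendsto_exp_atBot.comp (Real.tendsto_log_atTop.atTop_mul_neg h
    (((hv.tendsto_sum_floor_div (hθ.trans hcθ)).comp
      Real.tendsto_log_atTop).const_sub 1))).congr' ?_
  filter_upwards [eventually_gt_atTop 1] with A hA
  exact (hv.mul_stickRest_eq hA _).symm

theorem tendsto_stickRest (hv : IsRegularFractions θ v) (hθ : 0 < θ) :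
    Tendsto (stickRest v) atTop (𝓝 0) := by
  have h : Tendsto (fun n : ℕ => ∑ i ∈ Finset.range n, -Real.log (1 - v i)) atTop atTop := by
    refine (hv.tendsto.pos_mul_atTop (inv_pos.2 hθ) tendsto_natCast_atTop_atTop).congr' ?_
    filter_upwards [eventually_ge_atTop 1] with n hn
    have : (n : ℝ) ≠ 0 := by positivity
    field_simp
  simp_rw [funext hv.stickRest_eq]
  exact Real.tendsto_exp_neg_atTop_nhds_zero.comp h

theorem hasSum_stickBreaking (hv : IsRegularFractions θ v) (hθ : 0 < θ) :
    HasSum (stickBreaking v) 1 := by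
  rw [hasSum_iff_tendsto_nat_of_nonneg fun j => (hv.stickBreaking_pos j).le]
  simp_rw [sum_stickBreaking]
  simpa using (hv.tendsto_stickRest hθ).const_sub 1

end IsRegularFractions

/-! ### The conditional variance up to a martingale. -/

/-- Conditional variance, given the pieces of the stick, of the number of points in `[0, A]`. -/
noncomputable def stickVar (A : ℝ) (v : ℕ → ℝ) : ℝ := ∑' j, fractVar (A * stickBreaking v j)

/-- Conditional expectation of `fractVar (r * x)` for a `Beta(1, θ)` variable `x`. -/
noncomputable def meanFractVar (θ r : ℝ) : ℝ := ∫ x, fractVar (r * x) ∂betaMeasure 1 θ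

/-- The martingale part of the sum of the first `n` terms of `stickVar`. -/
noncomputable def stickMartingale (θ A : ℝ) (n : ℕ) (v : ℕ → ℝ) : ℝ :=
  ∑ j ∈ Finset.range n, (fractVar (A * stickBreaking v j) - meanFractVar θ (A * stickRest v j))

theorem meanFractVar_nonneg (θ r : ℝ) : 0 ≤ meanFractVar θ r :=
  integral_nonneg fun _ => fractVar_nonneg _

theorem meanFractVar_le_one {θ : ℝ} (hθ : 0 < θ) (r : ℝ) : meanFractVar θ r ≤ 1 := by
  have hp : IsProbabilityMeasure (betaMeasure 1 θ) := isProbabilityMeasureBeta one_pos hθ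
  refine (integral_mono_of_nonneg (ae_of_all _ fun _ => fractVar_nonneg _) (integrable_const 1)
    (ae_of_all _ fun _ => fractVar_le_one _)).trans (by simp)

theorem IsRegularFractions.summable_fractVar {θ : ℝ} {v : ℕ → ℝ} (hv : IsRegularFractions θ v)
    (hθ : 0 < θ) {A : ℝ} (hA : 0 ≤ A) : Summable fun j => fractVar (A * stickBreaking v j) :=
  Summable.of_nonneg_of_le (fun _ => fractVar_nonneg _)
    (fun j => fractVar_le_self (mul_nonneg hA (hv.stickBreaking_pos j).le))
    ((hv.hasSum_stickBreaking hθ).summable.mul_left A)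

/-- Beyond the `n`-th piece, `fractVar x ≤ x` applies, and the later pieces sum to the remaining
stick. -/
theorem IsRegularFractions.stickVar_le {θ : ℝ} {v : ℕ → ℝ} (hv : IsRegularFractions θ v)
    (hθ : 0 < θ) {A : ℝ} (hA : 0 ≤ A) (n : ℕ) :
    stickVar A v ≤ ∑ j ∈ Finset.range n, fractVar (A * stickBreaking v j) + A * stickRest v n := by
  have hs := hv.hasSum_stickBreaking hθ
  have h2 : ∑' j, A * stickBreaking v (j + n) = A * stickRest v n := by
    rw [tsum_mul_left]
    have := hs.summable.sum_add_tsum_nat_add n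
    rw [sum_stickBreaking, hs.tsum_eq] at this
    rw [show ∑' j, stickBreaking v (j + n) = stickRest v n by linarith]
  rw [stickVar, ← (hv.summable_fractVar hθ hA).sum_add_tsum_nat_add n, ← h2]
  gcongr with j
  · exact (summable_nat_add_iff n).2 (hv.summable_fractVar hθ hA)
  · exact (summable_nat_add_iff n).2 (hs.summable.mul_left A)
  · exact fractVar_le_self (mul_nonneg hA (hv.stickBreaking_pos _).le)

/-- Before `m` the conditional means are within `ε` of `1 / 6`. Between `m` and `m'` each index
costs at most `1`: through its mean up to `n`, through its variance term after `n`. Beyond `m'` the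
tail is bounded by `A` times the remaining stick. -/
theorem IsRegularFractions.abs_stickVar_sub_le {θ : ℝ} {v : ℕ → ℝ} (hv : IsRegularFractions θ v)
    (hθ : 0 < θ) {A ε : ℝ} (hA : 0 ≤ A) {m n m' : ℕ} (hmn : m ≤ n) (hnm : n ≤ m')
    (h1 : ∀ r, A * stickRest v m ≤ r → |meanFractVar θ r - 1 / 6| ≤ ε) :
    |stickVar A v - stickMartingale θ A n v - n / 6| ≤
      ε * m + (m' - m) + A * stickRest v m' := by
  have hup := hv.stickVar_le hθ hA m'
  have hlow : ∑ j ∈ Finset.range n, fractVar (A * stickBreaking v j) ≤ stickVar A v :=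
    (hv.summable_fractVar hθ hA).sum_le_tsum _ fun _ _ => fractVar_nonneg _
  have hmid : ∑ j ∈ Finset.range m', fractVar (A * stickBreaking v j) ≤
      ∑ j ∈ Finset.range n, fractVar (A * stickBreaking v j) + (m' - n) := by
    rw [← Finset.sum_range_add_sum_Ico _ hnm]
    gcongr
    refine (Finset.sum_le_card_nsmul _ _ 1 fun j _ => fractVar_le_one _).trans ?_
    simp [Nat.cast_sub hnm]
  have hM : stickMartingale θ A n v = ∑ j ∈ Finset.range n, fractVar (A * stickBreaking v j) -
      ∑ j ∈ Finset.range n, meanFractVar θ (A * stickRest v j) := Finset.sum_sub_distrib ..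
  have hmean : |∑ j ∈ Finset.range n, meanFractVar θ (A * stickRest v j) - n / 6| ≤
      ε * m + (n - m) := by
    have : ∑ j ∈ Finset.range n, meanFractVar θ (A * stickRest v j) - n / 6 =
        ∑ j ∈ Finset.range n, (meanFractVar θ (A * stickRest v j) - 1 / 6) := by
      rw [Finset.sum_sub_distrib]
      simp
      ring
    rw [this]
    refine (Finset.abs_sum_le_sum_abs _ _).trans ?_
    rw [← Finset.sum_range_add_sum_Ico _ hmn]
    refine add_le_add ?_ ?_
    · refine (Finset.sum_le_card_nsmul _ _ ε fun j hj => h1 _ ?_).trans (by simp [mul_comm])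
      exact mul_le_mul_of_nonneg_left
        (hv.antitone_stickRest (Finset.mem_range.1 hj).le) hA
    · refine (Finset.sum_le_card_nsmul _ _ 1 fun j _ => ?_).trans (by simp [Nat.cast_sub hmn])
      have := meanFractVar_nonneg θ (A * stickRest v j)
      have := meanFractVar_le_one hθ (A * stickRest v j)
      rw [abs_le]
      constructor <;> linarith
  have hR : 0 ≤ A * stickRest v m' := mul_nonneg hA (hv.stickRest_pos _).le
  have hnm' : (n : ℝ) ≤ m' := by exact_mod_cast hnm
  rw [abs_le] at hmean ⊢
  rw [hM]
  constructor <;> linarith [hmean.1, hmean.2]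

theorem IsRegularFractions.tendsto_stickVar_sub_div {θ : ℝ} {v : ℕ → ℝ}
    (hv : IsRegularFractions θ v) (hθ : 0 < θ) :
    Tendsto (fun A : ℝ => (stickVar A v - stickMartingale θ A ⌊θ * Real.log A⌋₊ v) / Real.log A)
      atTop (𝓝 (θ / 6)) := by
  rw [Metric.tendsto_nhds]
  intro δ hδ
  -- With cutoffs `(1 ± ε) * θ * L`, where `L = log A`, the errors are at most `3 * ε * θ * L` plus
  -- rounding and tail terms below `4`. The latter are absorbed by one more `ε * θ * L` once `A` is
  -- large, whence the factor `4`.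
  obtain ⟨ε, hε, hε1, hεδ⟩ : ∃ ε : ℝ, 0 < ε ∧ ε < 1 ∧ 4 * ε * θ < δ := by
    refine ⟨min (1 / 2) (δ / (8 * θ)), by positivity, by
      linarith [min_le_left (1 / 2) (δ / (8 * θ))], ?_⟩
    have := min_le_right (1 / 2) (δ / (8 * θ))
    calc 4 * min (1 / 2) (δ / (8 * θ)) * θ ≤ 4 * (δ / (8 * θ)) * θ := by gcongr
      _ = δ / 2 := by field_simp; norm_num
      _ < δ := by linarith
  obtain ⟨r₀, hr₀⟩ := eventually_atTop.1
    (Metric.tendsto_nhds.1 (tendsto_integral_fractVar_betaMeasure hθ) ε hε)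
  have e1 := (hv.tendsto_mul_stickRest_atTop hθ (c := (1 - ε) * θ)
    (mul_pos (by linarith) hθ) (by nlinarith)).eventually_ge_atTop r₀
  have e2 := (hv.tendsto_mul_stickRest_zero hθ (c := (1 + ε) * θ)
    (by nlinarith)).eventually (gt_mem_nhds one_pos)
  have e3 := Real.tendsto_log_atTop.eventually_gt_atTop (4 / (ε * θ))
  filter_upwards [e1, e2, e3, eventually_gt_atTop 1] with A h1 h2 h3 hA
  set L := Real.log A with hL
  have hLpos : 0 < L := Real.log_pos hA
  have hθL : 0 < θ * L := by positivity
  have hεL : 0 < ε * (θ * L) := by positivity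
  have k1 : (1 - ε) * θ * L ≤ θ * L := by nlinarith
  have k2 : θ * L ≤ (1 + ε) * θ * L := by nlinarith
  have k0 : 0 ≤ (1 - ε) * θ * L := by
    have : 0 ≤ 1 - ε := by linarith
    positivity
  have hb := hv.abs_stickVar_sub_le hθ (A := A) (ε := ε) (by linarith)
    (Nat.floor_mono k1) (Nat.floor_mono k2) fun r hr => (hr₀ r (h1.trans hr)).le
  have f1 := Nat.floor_le k0
  have f2 := Nat.lt_floor_add_one ((1 - ε) * θ * L)
  have f3 := Nat.floor_le (k0.trans (k1.trans k2))
  have f4 := Nat.floor_le hθL.le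
  have f5 := Nat.lt_floor_add_one (θ * L)
  have f6 : ε * (⌊(1 - ε) * θ * L⌋₊ : ℝ) ≤ ε * (θ * L) := by gcongr; linarith
  have h3' : 4 < ε * (θ * L) := by
    rw [div_lt_iff₀ (by positivity)] at h3
    linarith
  rw [Real.dist_eq]
  have heq : (stickVar A v - stickMartingale θ A ⌊θ * L⌋₊ v) / L - θ / 6 =
      (stickVar A v - stickMartingale θ A ⌊θ * L⌋₊ v - θ * L / 6) / L := by
    field_simp
  rw [heq, abs_div, abs_of_pos hLpos, div_lt_iff₀ hLpos]
  have hδL : 4 * ε * θ * L < δ * L := by gcongr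
  rw [abs_lt]
  rw [abs_le] at hb
  constructor <;> linarith [hb.1, hb.2]

/-! ### Second moment of the martingale. -/

/-- The sequence `v` with all entries from the `n`-th on replaced by zero. -/
def truncateFrom (n : ℕ) (v : ℕ → ℝ) : ℕ → ℝ := fun i => if i < n then v i else 0

theorem measurable_truncateFrom (n : ℕ) : Measurable (truncateFrom n) := by
  refine measurable_pi_lambda _ fun i => ?_
  unfold truncateFrom
  split_ifs <;> fun_prop

theorem stickRest_truncateFrom {n j : ℕ} (hj : j ≤ n) (v : ℕ → ℝ) :
    stickRest (truncateFrom n v) j = stickRest v j := by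
  refine Finset.prod_congr rfl fun i hi => ?_
  rw [truncateFrom, if_pos ((Finset.mem_range.1 hi).trans_le hj)]

theorem stickMartingale_truncateFrom (θ A : ℝ) (n : ℕ) (v : ℕ → ℝ) :
    stickMartingale θ A n (truncateFrom n v) = stickMartingale θ A n v := by
  refine Finset.sum_congr rfl fun j hj => ?_
  have hj := Finset.mem_range.1 hj
  rw [stickBreaking_apply, stickBreaking_apply, stickRest_truncateFrom hj.le, truncateFrom,
    if_pos hj]

/-- This plays the role of conditioning on the first `n` fractions: they are independent of the next
one, which can be integrated out first. Truncation keeps the past in sequence space, so that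
`stickRest` and `stickMartingale` can be evaluated on it. -/
theorem integral_truncateFrom_eval (κ : Measure ℝ) [IsProbabilityMeasure κ] (n : ℕ)
    {F : (ℕ → ℝ) × ℝ → ℝ} (hF : Measurable F) {C : ℝ} (hC : ∀ p, |F p| ≤ C) :
    ∫ v, F (truncateFrom n v, v n) ∂(Measure.infinitePi fun _ : ℕ => κ) =
      ∫ v, ∫ x, F (truncateFrom n v, x) ∂κ ∂(Measure.infinitePi fun _ : ℕ => κ) := by
  set μ := Measure.infinitePi fun _ : ℕ => κ
  have hind : iIndepFun (fun (i : ℕ) (v : ℕ → ℝ) => v i) μ :=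
    iIndepFun_infinitePi (X := fun _ x => x) fun _ => measurable_id
  have hφ : Measurable fun (w : Finset.range n → ℝ) (i : ℕ) =>
      if h : i ∈ Finset.range n then w ⟨i, h⟩ else 0 :=
    measurable_pi_lambda _ fun i => by split_ifs <;> fun_prop
  have hψ : Measurable fun w : ({n} : Finset ℕ) → ℝ => w ⟨n, Finset.mem_singleton_self n⟩ :=
    measurable_pi_apply _
  have h1 := (hind.indepFun_finset (Finset.range n) {n} (by simp) (by fun_prop)).comp hφ hψ
  have h2 : IndepFun (truncateFrom n) (fun v => v n) μ := by
    convert h1 using 1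
    · ext v i
      by_cases hi : i < n <;> simp [truncateFrom, hi]
    · rfl
  have hm := measurable_truncateFrom n
  have hmap := (indepFun_iff_map_prod_eq_prod_map_map (μ := μ) hm.aemeasurable
    (measurable_pi_apply n).aemeasurable).1 h2
  have hev : μ.map (fun v : ℕ → ℝ => v n) = κ :=
    (measurePreserving_eval_infinitePi (fun _ : ℕ => κ) n).map_eq
  rw [hev] at hmap
  have : IsProbabilityMeasure (μ.map (truncateFrom n)) :=
    Measure.isProbabilityMeasure_map hm.aemeasurable
  rw [← integral_map (φ := fun v : ℕ → ℝ => (truncateFrom n v, v n)) (f := F)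
      (hm.prodMk (measurable_pi_apply n)).aemeasurable hF.aestronglyMeasurable, hmap,
    integral_prod _ (Integrable.of_bound hF.aestronglyMeasurable C (ae_of_all _ hC)),
    integral_map hm.aemeasurable
      hF.stronglyMeasurable.integral_prod_right'.aestronglyMeasurable]

theorem measurable_meanFractVar {θ : ℝ} (hθ : 0 < θ) : Measurable (meanFractVar θ) := by
  have hp : IsProbabilityMeasure (betaMeasure 1 θ) := isProbabilityMeasureBeta one_pos hθ
  exact (StronglyMeasurable.integral_prod_right' (f := fun p : ℝ × ℝ => fractVar (p.1 * p.2))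
    (measurable_fractVar.comp (by fun_prop)).stronglyMeasurable).measurable

theorem measurable_stickBreaking_apply (j : ℕ) : Measurable fun v => stickBreaking v j :=
  (measurable_pi_apply j).comp measurable_stickBreaking

theorem measurable_stickMartingale {θ : ℝ} (hθ : 0 < θ) (A : ℝ) (n : ℕ) :
    Measurable (stickMartingale θ A n) := by
  have h1 := measurable_meanFractVar hθ
  have h2 := measurable_fractVar
  refine Finset.measurable_fun_sum _ fun j _ => Measurable.sub (h2.comp ?_) (h1.comp ?_)
  · exact (measurable_stickBreaking_apply j).const_mul A
  · exact (measurable_stickRest j).const_mul A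

theorem abs_fractVar_sub_meanFractVar_le {θ : ℝ} (hθ : 0 < θ) (x r : ℝ) :
    |fractVar x - meanFractVar θ r| ≤ 1 := by
  have := fractVar_nonneg x
  have := fractVar_le_one x
  have := meanFractVar_nonneg θ r
  have := meanFractVar_le_one hθ r
  rw [abs_le]
  constructor <;> linarith

theorem abs_stickMartingale_le {θ : ℝ} (hθ : 0 < θ) (A : ℝ) (n : ℕ) (v : ℕ → ℝ) :
    |stickMartingale θ A n v| ≤ n := by
  refine (Finset.abs_sum_le_sum_abs _ _).trans ((Finset.sum_le_card_nsmul _ _ 1 fun j _ =>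
    abs_fractVar_sub_meanFractVar_le hθ _ _).trans (by simp))

/-- Martingale increments are orthogonal, so the second moment is the sum of those of the
increments, each at most `1`. -/
theorem integral_stickMartingale_sq_le {θ : ℝ} (hθ : 0 < θ) (A : ℝ) (n : ℕ) :
    ∫ v, stickMartingale θ A n v ^ 2 ∂(Measure.infinitePi fun _ : ℕ => betaMeasure 1 θ) ≤ n := by
  have hp : IsProbabilityMeasure (betaMeasure 1 θ) := isProbabilityMeasureBeta one_pos hθ
  have hmM (n : ℕ) := measurable_stickMartingale hθ A n
  have hmf := measurable_fractVar
  have hmh := measurable_meanFractVar hθ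
  induction n with
  | zero => simp [stickMartingale]
  | succ n ih =>
    set μ := Measure.infinitePi fun _ : ℕ => betaMeasure 1 θ
    set Z : (ℕ → ℝ) → ℝ := fun v =>
      fractVar (A * stickBreaking v n) - meanFractVar θ (A * stickRest v n) with hZ
    have hmZ : Measurable Z :=
      (hmf.comp ((measurable_stickBreaking_apply n).const_mul A)).sub
        (hmh.comp ((measurable_stickRest n).const_mul A))
    have hZ1 (v) : |Z v| ≤ 1 := abs_fractVar_sub_meanFractVar_le hθ _ _
    have hMZ (v) : |stickMartingale θ A n v * Z v| ≤ n := by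
      rw [abs_mul]
      exact (mul_le_mul (abs_stickMartingale_le hθ A n v) (hZ1 v) (abs_nonneg _)
        n.cast_nonneg).trans (mul_one _).le
    have hsucc (v) : stickMartingale θ A (n + 1) v = stickMartingale θ A n v + Z v :=
      Finset.sum_range_succ ..
    have hM2 : Integrable (fun v => stickMartingale θ A n v ^ 2) μ :=
      Integrable.of_bound ((hmM n).pow_const 2).aestronglyMeasurable (n ^ 2)
        (ae_of_all _ fun v => by
        rw [norm_pow]
        exact pow_le_pow_left₀ (abs_nonneg _) (abs_stickMartingale_le hθ A n v) 2)
    have hiMZ : Integrable (fun v => stickMartingale θ A n v * Z v) μ :=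
      Integrable.of_bound ((hmM n).mul hmZ).aestronglyMeasurable n (ae_of_all _ hMZ)
    have hZ2le (v) : ‖Z v ^ 2‖ ≤ 1 := by
      rw [norm_pow]
      exact pow_le_one₀ (abs_nonneg _) (hZ1 v)
    have hZ2 : Integrable (fun v => Z v ^ 2) μ :=
      Integrable.of_bound (hmZ.pow_const 2).aestronglyMeasurable 1 (ae_of_all _ hZ2le)
    have hcross : ∫ v, stickMartingale θ A n v * Z v ∂μ = 0 := by
      -- The cross term as a function of the past and the new fraction; integrating over the
      -- fraction gives zero by the definition of `meanFractVar`.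
      set F : (ℕ → ℝ) × ℝ → ℝ := fun p => stickMartingale θ A n p.1 *
        (fractVar (A * stickRest p.1 n * p.2) - meanFractVar θ (A * stickRest p.1 n)) with hF
      have hmr : Measurable fun p : (ℕ → ℝ) × ℝ => A * stickRest p.1 n :=
        ((measurable_stickRest n).comp measurable_fst).const_mul A
      have hmF : Measurable F := ((hmM n).comp measurable_fst).mul
        ((hmf.comp (hmr.mul measurable_snd)).sub (hmh.comp hmr))
      have key := integral_truncateFrom_eval (betaMeasure 1 θ) n hmF (C := n) fun p => by
        rw [hF, abs_mul]
        exact (mul_le_mul (abs_stickMartingale_le hθ A n _)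
          (abs_fractVar_sub_meanFractVar_le hθ _ _) (abs_nonneg _)
          n.cast_nonneg).trans (mul_one _).le
      have e1 (v : ℕ → ℝ) : F (truncateFrom n v, v n) = stickMartingale θ A n v * Z v := by
        simp only [hF, hZ, stickMartingale_truncateFrom, stickRest_truncateFrom le_rfl,
          stickBreaking_apply]
        ring_nf
      have e2 (w : ℕ → ℝ) : ∫ x, F (w, x) ∂betaMeasure 1 θ = 0 := by
        simp only [hF]
        rw [integral_const_mul, integral_sub _ (integrable_const _)]
        · simp [meanFractVar]
        · exact Integrable.of_bound (hmf.comp (by fun_prop)).aestronglyMeasurable 1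
            (ae_of_all _ fun x => abs_fractVar_le_one _)
      simp_rw [e1, e2, integral_zero] at key
      exact key
    calc ∫ v, stickMartingale θ A (n + 1) v ^ 2 ∂μ
        = ∫ v, stickMartingale θ A n v ^ 2 +
            (2 * (stickMartingale θ A n v * Z v) + Z v ^ 2) ∂μ := by
          congr 1; ext v; rw [hsucc]; ring
      _ = ∫ v, stickMartingale θ A n v ^ 2 ∂μ + (2 * 0 + ∫ v, Z v ^ 2 ∂μ) := by
          have h2 : Integrable (fun v => 2 * (stickMartingale θ A n v * Z v) + Z v ^ 2) μ :=
            (hiMZ.const_mul 2).add hZ2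
          rw [integral_add hM2 h2, integral_add (hiMZ.const_mul 2) hZ2, integral_const_mul,
            hcross]
      _ ≤ n + (2 * 0 + 1) := by
          gcongr
          refine (integral_mono hZ2 (integrable_const 1) fun v => ?_).trans (by simp)
          exact (le_abs_self _).trans (hZ2le v)
      _ = ((n + 1 : ℕ) : ℝ) := by push_cast; ring

/-- The second moment bound with `n ≤ θ * log A` gives an `L¹` norm of at most `θ / log A`. -/
theorem tendstoInMeasure_stickMartingale_sq {θ : ℝ} (hθ : 0 < θ) {A : ℕ → ℝ}
    (hA : Tendsto A atTop atTop) :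
    TendstoInMeasure (Measure.infinitePi fun _ : ℕ => betaMeasure 1 θ)
      (fun k v => (stickMartingale θ (A k) ⌊θ * Real.log (A k)⌋₊ v / Real.log (A k)) ^ 2)
      atTop (fun _ => 0) := by
  have hp : IsProbabilityMeasure (betaMeasure 1 θ) := isProbabilityMeasureBeta one_pos hθ
  have hL := Real.tendsto_log_atTop.comp hA
  have hm (k : ℕ) : Measurable fun v =>
      (stickMartingale θ (A k) ⌊θ * Real.log (A k)⌋₊ v / Real.log (A k)) ^ 2 :=
    ((measurable_stickMartingale hθ _ _).div_const _).pow_const 2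
  refine tendstoInMeasure_of_tendsto_eLpNorm one_ne_zero (fun k => (hm k).aestronglyMeasurable)
    aestronglyMeasurable_const ?_
  have hlim : Tendsto (fun k => ENNReal.ofReal (θ / Real.log (A k))) atTop (𝓝 0) := by
    have := hL.const_div_atTop θ
    simpa using ENNReal.tendsto_ofReal this
  refine tendsto_of_tendsto_of_tendsto_of_le_of_le' tendsto_const_nhds hlim
    (Eventually.of_forall fun _ => zero_le) ?_
  filter_upwards [hL.eventually_gt_atTop 0] with k hk
  simp only [Function.comp_apply] at hk
  rw [eLpNorm_one_eq_lintegral_enorm]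
  have hi : Integrable (fun v => (stickMartingale θ (A k) ⌊θ * Real.log (A k)⌋₊ v /
      Real.log (A k)) ^ 2) (Measure.infinitePi fun _ : ℕ => betaMeasure 1 θ) := by
    refine Integrable.of_bound (hm k).aestronglyMeasurable
      ((⌊θ * Real.log (A k)⌋₊ / Real.log (A k)) ^ 2) (ae_of_all _ fun v => ?_)
    rw [norm_pow, norm_div, Real.norm_of_nonneg hk.le]
    gcongr
    exact abs_stickMartingale_le hθ _ _ v
  simp_rw [Pi.sub_apply, sub_zero, fun v => Real.enorm_of_nonneg
    (sq_nonneg (stickMartingale θ (A k) ⌊θ * Real.log (A k)⌋₊ v / Real.log (A k)))]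
  rw [← ofReal_integral_eq_lintegral_ofReal hi (ae_of_all _ fun v => sq_nonneg _)]
  refine ENNReal.ofReal_le_ofReal ?_
  simp_rw [div_pow]
  rw [integral_div, div_le_iff₀ (by positivity)]
  refine (integral_stickMartingale_sq_le hθ _ _).trans ((Nat.floor_le (by positivity)).trans ?_)
  apply le_of_eq
  field_simp

/-- Along a subsequence, the conditional variance is almost surely asymptotic to
`θ / 6 * log A`. -/
theorem exists_seq_tendsto_stickVar {θ : ℝ} (hθ : 0 < θ) {A : ℕ → ℝ}
    (hA : Tendsto A atTop atTop) :
    ∃ ns : ℕ → ℕ, StrictMono ns ∧ ∀ᵐ v ∂Measure.infinitePi fun _ : ℕ => betaMeasure 1 θ,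
      Tendsto (fun k => stickVar (A (ns k)) v / Real.log (A (ns k))) atTop (𝓝 (θ / 6)) := by
  obtain ⟨ns, hns, hlim⟩ := (tendstoInMeasure_stickMartingale_sq hθ hA).exists_seq_tendsto_ae
  refine ⟨ns, hns, ?_⟩
  filter_upwards [hlim, ae_isRegularFractions hθ] with v hv hreg
  have h1 := (hreg.tendsto_stickVar_sub_div hθ).comp (hA.comp hns.tendsto_atTop)
  have h2 : Tendsto (fun k => stickMartingale θ (A (ns k)) ⌊θ * Real.log (A (ns k))⌋₊ v /
      Real.log (A (ns k))) atTop (𝓝 0) := by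
    rw [tendsto_zero_iff_abs_tendsto_zero]
    have := (Real.continuous_sqrt.tendsto 0).comp hv
    simpa [Function.comp_def, Real.sqrt_sq_eq_abs] using this
  have h3 := h1.add h2
  rw [add_zero] at h3
  refine h3.congr fun k => ?_
  simp only [Function.comp_apply]
  ring

/-! ### Gaussian approximation of Bernoulli characteristic functions. -/

theorem norm_prod_sub_prod_le_sum {ι : Type*} (s : Finset ι) (a b : ι → ℂ)
    (ha : ∀ i ∈ s, ‖a i‖ ≤ 1) (hb : ∀ i ∈ s, ‖b i‖ ≤ 1) :
    ‖∏ i ∈ s, a i - ∏ i ∈ s, b i‖ ≤ ∑ i ∈ s, ‖a i - b i‖ := by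
  classical
  induction s using Finset.induction_on with
  | empty => simp
  | insert i s hi ih =>
    rw [Finset.prod_insert hi, Finset.prod_insert hi, Finset.sum_insert hi]
    have h1 := ih (fun j hj => ha j (Finset.mem_insert_of_mem hj))
      fun j hj => hb j (Finset.mem_insert_of_mem hj)
    have h2 : ‖∏ j ∈ s, a j‖ ≤ 1 := by
      rw [norm_prod]
      exact Finset.prod_le_one (fun _ _ => norm_nonneg _)
        fun j hj => ha j (Finset.mem_insert_of_mem hj)
    calc ‖a i * ∏ j ∈ s, a j - b i * ∏ j ∈ s, b j‖
        = ‖(a i - b i) * ∏ j ∈ s, a j + b i * (∏ j ∈ s, a j - ∏ j ∈ s, b j)‖ := by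
          congr 1; ring
      _ ≤ ‖a i - b i‖ * ‖∏ j ∈ s, a j‖ + ‖b i‖ * ‖∏ j ∈ s, a j - ∏ j ∈ s, b j‖ := by
          refine (norm_add_le _ _).trans ?_
          rw [norm_mul, norm_mul]
      _ ≤ ‖a i - b i‖ * 1 + 1 * ∑ j ∈ s, ‖a j - b j‖ := by
          gcongr
          exact hb i (Finset.mem_insert_self i s)
      _ = _ := by ring

/-- The characteristic function of a centred Bernoulli variable with parameter `p`. -/
noncomputable def centredBernoulliCharFun (p s : ℝ) : ℂ :=
  p * Complex.exp ((s * (1 - p) : ℝ) * Complex.I) +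
    (1 - p) * Complex.exp ((s * -p : ℝ) * Complex.I)

theorem norm_exp_mul_I_sub_taylor_le {a : ℝ} (ha : |a| ≤ 1) :
    ‖Complex.exp (a * Complex.I) - (1 + a * Complex.I - a ^ 2 / 2)‖ ≤ |a| ^ 3 := by
  have hn : ‖(a : ℂ) * Complex.I‖ = |a| := by simp
  have h := Complex.exp_bound (x := a * Complex.I) (by rw [hn]; exact ha) (n := 3) (by norm_num)
  rw [hn] at h
  have hs : ∑ m ∈ Finset.range 3, ((a : ℂ) * Complex.I) ^ m / m.factorial =
      1 + a * Complex.I - a ^ 2 / 2 := by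
    simp [Finset.sum_range_succ, Nat.factorial, mul_pow]
    ring
  rw [hs] at h
  refine h.trans (mul_le_of_le_one_right (by positivity) ?_)
  norm_num [Nat.factorial]

/-- Centring cancels the linear Taylor terms, and the quadratic ones agree with those of the
Gaussian factor. The factor `p * (1 - p)` in the error is what lets the errors be summed over
infinitely many pieces. -/
theorem norm_centredBernoulliCharFun_sub_le {p s : ℝ} (hp0 : 0 ≤ p) (hp1 : p ≤ 1)
    (hs : |s| ≤ 1) :
    ‖centredBernoulliCharFun p s - Complex.exp ((-(s ^ 2 * (p * (1 - p)) / 2) : ℝ))‖ ≤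
      2 * |s| ^ 3 * (p * (1 - p)) := by
  have hq0 : 0 ≤ 1 - p := by linarith
  have hs0 := abs_nonneg s
  have ha1 : |s * (1 - p)| = |s| * (1 - p) := by rw [abs_mul, abs_of_nonneg hq0]
  have ha2 : |s * -p| = |s| * p := by rw [abs_mul, abs_neg, abs_of_nonneg hp0]
  have h1 := norm_exp_mul_I_sub_taylor_le (a := s * (1 - p)) (by rw [ha1]; nlinarith)
  have h2 := norm_exp_mul_I_sub_taylor_le (a := s * -p) (by rw [ha2]; nlinarith)
  rw [ha1] at h1
  rw [ha2] at h2
  have hs2 : s ^ 2 = |s| ^ 2 := (sq_abs s).symm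
  have hpq : 0 ≤ p * (1 - p) := mul_nonneg hp0 hq0
  have hpq1 : p * (1 - p) ≤ 1 := by nlinarith
  set u := s ^ 2 * (p * (1 - p)) / 2 with hu
  have hu0 : 0 ≤ u := by positivity
  have hss : s ^ 2 ≤ 1 := by rw [hs2]; nlinarith
  have hu1 : u ≤ 1 := by
    have : s ^ 2 * (p * (1 - p)) ≤ 1 := by nlinarith
    linarith
  have h3 : ‖Complex.exp ((-u : ℝ)) - (1 - u)‖ ≤ u ^ 2 := by
    have := Real.abs_exp_sub_one_sub_id_le (x := -u) (by rw [abs_neg, abs_of_nonneg hu0]; exact hu1)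
    rw [← Complex.ofReal_exp, ← Complex.ofReal_one, ← Complex.ofReal_sub, ← Complex.ofReal_sub,
      Complex.norm_real, Real.norm_eq_abs]
    rwa [show Real.exp (-u) - (1 - u) = Real.exp (-u) - 1 - -u by ring, ← neg_sq u]
  -- The square has surplus factors `|s|` and `p * (1 - p)`, both at most `1`.
  have hu2 : u ^ 2 ≤ |s| ^ 3 * (p * (1 - p)) := by
    have e : u ^ 2 = |s| ^ 3 * (p * (1 - p)) * (|s| * (p * (1 - p)) / 4) := by
      rw [hu, hs2]; ring
    rw [e]
    refine mul_le_of_le_one_right (by positivity) ?_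
    nlinarith
  have hdec : centredBernoulliCharFun p s - Complex.exp ((-u : ℝ)) =
      p * (Complex.exp ((s * (1 - p) : ℝ) * Complex.I) -
        (1 + (s * (1 - p) : ℝ) * Complex.I - (s * (1 - p) : ℝ) ^ 2 / 2)) +
      (1 - p) * (Complex.exp ((s * -p : ℝ) * Complex.I) -
        (1 + (s * -p : ℝ) * Complex.I - (s * -p : ℝ) ^ 2 / 2)) -
      (Complex.exp ((-u : ℝ)) - (1 - u)) := by
    rw [centredBernoulliCharFun, hu]
    push_cast
    ring
  have hnp : ‖(p : ℂ)‖ = p := by rw [Complex.norm_real, Real.norm_of_nonneg hp0]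
  have hnq : ‖(1 - p : ℂ)‖ = 1 - p := by
    rw [← Complex.ofReal_one, ← Complex.ofReal_sub, Complex.norm_real, Real.norm_of_nonneg hq0]
  rw [hdec]
  calc _ ≤ p * (|s| * (1 - p)) ^ 3 + (1 - p) * (|s| * p) ^ 3 + u ^ 2 := by
        refine (norm_sub_le _ _).trans (add_le_add ((norm_add_le _ _).trans ?_) h3)
        rw [norm_mul, norm_mul, hnp, hnq]
        gcongr
    _ = |s| ^ 3 * (p * (1 - p)) * ((1 - p) ^ 2 + p ^ 2) + u ^ 2 := by ring
    _ ≤ |s| ^ 3 * (p * (1 - p)) * 1 + |s| ^ 3 * (p * (1 - p)) := by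
        gcongr
        nlinarith
    _ = _ := by ring

/-! ### Counting points for fixed pieces. -/

/-- The number of points of the coset `φ + ℤ` in `[0, x]`, minus its expectation `x` for uniform
`φ` (see `sum_dirac_Icc`). -/
noncomputable def centredCount (x φ : ℝ) : ℝ := (Iic (Int.fract x)).indicator 1 φ - Int.fract x

theorem measurable_centredCount (x : ℝ) : Measurable (centredCount x) :=
  (measurable_one.indicator measurableSet_Iic).sub_const _

/-- For `x ≥ 0` the points `k + φ` in `[0, x]` are those with `0 ≤ k ≤ ⌊x - φ⌋`. This floor is `⌊x⌋`
or `⌊x⌋ - 1`, according to whether `φ` is at most the fractional part of `x`. -/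
theorem floor_sub_add_one (x : ℝ) {φ : ℝ} (hφ : φ ∈ Ico (0 : ℝ) 1) :
    ((⌊x - φ⌋ + 1 : ℤ) : ℝ) = x + centredCount x φ := by
  have h0 := Int.fract_nonneg x
  have h1 := Int.fract_lt_one x
  have hx := Int.floor_add_fract x
  by_cases h : φ ≤ Int.fract x
  · have : ⌊x - φ⌋ = ⌊x⌋ := by
      rw [Int.floor_eq_iff]
      constructor <;> linarith [hφ.1]
    rw [this, centredCount, indicator_of_mem (mem_Iic.2 h)]
    push_cast
    simp only [Pi.one_apply]
    linarith
  · have : ⌊x - φ⌋ = ⌊x⌋ - 1 := by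
      rw [Int.floor_eq_iff]
      push_cast
      constructor <;> linarith [hφ.2]
    rw [this, centredCount, indicator_of_notMem (by simpa using h)]
    push_cast
    linarith

theorem add_centredCount_nonneg {x φ : ℝ} (hx : 0 ≤ x) (hφ : φ ∈ Ico (0 : ℝ) 1) :
    0 ≤ x + centredCount x φ := by
  rw [← floor_sub_add_one x hφ]
  have : (-1 : ℤ) ≤ ⌊x - φ⌋ := by
    rw [Int.le_floor]
    push_cast
    linarith [hφ.2]
  exact_mod_cast (by omega : (0 : ℤ) ≤ ⌊x - φ⌋ + 1)

theorem sum_dirac_Icc {y φ A : ℝ} (hy : 0 < y) (hφ : φ ∈ Ico (0 : ℝ) 1) (hA : 0 ≤ A) :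
    (Measure.sum fun k : ℤ => Measure.dirac (((k : ℝ) + φ) / y)) (Icc 0 A) =
      ENNReal.ofReal (A * y + centredCount (A * y) φ) := by
  have hx : 0 ≤ A * y := by positivity
  have hmem (k : ℤ) : ((k : ℝ) + φ) / y ∈ Icc 0 A ↔ k ∈ Finset.Icc 0 ⌊A * y - φ⌋ := by
    rw [mem_Icc, div_le_iff₀ hy, Finset.mem_Icc, Int.le_floor, le_sub_iff_add_le]
    refine and_congr_left fun _ => ?_
    rw [le_div_iff₀ hy, zero_mul]
    constructor
    · intro h
      have : (-1 : ℝ) < k := by linarith [hφ.2]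
      have : (-1 : ℤ) < k := by exact_mod_cast this
      omega
    · intro h
      have : (0 : ℝ) ≤ k := by exact_mod_cast h
      linarith [hφ.1]
  have h0 := add_centredCount_nonneg hx hφ
  rw [← floor_sub_add_one _ hφ] at h0 ⊢
  rw [Measure.sum_apply _ measurableSet_Icc]
  have hd (k : ℤ) : Measure.dirac (((k : ℝ) + φ) / y) (Icc 0 A) =
      if k ∈ Finset.Icc 0 ⌊A * y - φ⌋ then 1 else 0 := by
    rw [Measure.dirac_apply' _ measurableSet_Icc, indicator_apply]
    simp only [hmem, Pi.one_apply]
  have h0' : 0 ≤ ⌊A * y - φ⌋ + 1 := by exact_mod_cast h0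
  simp_rw [hd]
  rw [tsum_eq_sum (s := Finset.Icc 0 ⌊A * y - φ⌋) fun k hk => if_neg hk,
    Finset.sum_congr rfl fun k hk => if_pos hk, Finset.sum_const, Int.card_Icc, sub_zero,
    nsmul_eq_mul, mul_one]
  have hn : ((⌊A * y - φ⌋ + 1 : ℤ) : ℝ) = (((⌊A * y - φ⌋ + 1).toNat : ℕ) : ℝ) := by
    exact_mod_cast (Int.toNat_of_nonneg h0').symm
  rw [hn, ENNReal.ofReal_natCast]

theorem isProbabilityMeasure_restrict_Ico :
    IsProbabilityMeasure (volume.restrict (Ico (0 : ℝ) 1)) := ⟨by simp⟩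

theorem restrict_Ico_real_Iic {p : ℝ} (hp0 : 0 ≤ p) (hp1 : p < 1) :
    (volume.restrict (Ico (0 : ℝ) 1)).real (Iic p) = p := by
  rw [measureReal_restrict_apply measurableSet_Iic]
  have : Iic p ∩ Ico (0 : ℝ) 1 = Icc 0 p := by
    ext x
    simp only [mem_inter_iff, mem_Iic, mem_Ico, mem_Icc]
    constructor
    · rintro ⟨h1, h2, _⟩; exact ⟨h2, h1⟩
    · rintro ⟨h1, h2⟩; exact ⟨h2, h1, by linarith⟩
  rw [this, Real.volume_real_Icc_of_le hp0, sub_zero]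

theorem integral_centredCount (x : ℝ) :
    ∫ φ, centredCount x φ ∂volume.restrict (Ico (0 : ℝ) 1) = 0 := by
  have := isProbabilityMeasure_restrict_Ico
  unfold centredCount
  rw [integral_sub _ (integrable_const _), integral_indicator_one measurableSet_Iic,
    restrict_Ico_real_Iic (Int.fract_nonneg x) (Int.fract_lt_one x)]
  · simp
  · exact (integrable_const (1 : ℝ)).indicator measurableSet_Iic

theorem integrable_centredCount (x : ℝ) :
    Integrable (centredCount x) (volume.restrict (Ico (0 : ℝ) 1)) := by
  have := isProbabilityMeasure_restrict_Ico
  exact ((integrable_const (1 : ℝ)).indicator measurableSet_Iic).sub (integrable_const _)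

theorem integral_exp_centredCount (x s : ℝ) :
    ∫ φ, Complex.exp (s * centredCount x φ * Complex.I) ∂volume.restrict (Ico (0 : ℝ) 1) =
      centredBernoulliCharFun (Int.fract x) s := by
  have := isProbabilityMeasure_restrict_Ico
  set p := Int.fract x with hp
  set a := Complex.exp ((s * (1 - p) : ℝ) * Complex.I) with ha
  set b := Complex.exp ((s * -p : ℝ) * Complex.I) with hb
  have h (φ : ℝ) : Complex.exp (s * centredCount x φ * Complex.I) =
      b + (Iic p).indicator (fun _ => a - b) φ := by
    by_cases hφ : φ ∈ Iic p
    · rw [indicator_of_mem hφ, centredCount, indicator_of_mem hφ, ha]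
      simp [← hp]
    · rw [indicator_of_notMem hφ, centredCount, indicator_of_notMem hφ, hb]
      simp [← hp]
  simp_rw [h]
  rw [integral_add (integrable_const _) ((integrable_const _).indicator measurableSet_Iic),
    integral_indicator_const _ measurableSet_Iic,
    restrict_Ico_real_Iic (Int.fract_nonneg x) (Int.fract_lt_one x), centredBernoulliCharFun]
  simp only [integral_const, probReal_univ, one_smul, Complex.real_smul]
  ring

theorem eigenanglePointMeasure_Icc {y φ : ℕ → ℝ} (hy : ∀ j, 0 < y j)
    (hφ : ∀ j, φ j ∈ Ico (0 : ℝ) 1) {A : ℝ} (hA : 0 ≤ A) :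
    eigenanglePointMeasure y φ (Icc 0 A) =
      ∑' j, ENNReal.ofReal (A * y j + centredCount (A * y j) (φ j)) := by
  rw [eigenanglePointMeasure, Measure.sum_apply _ measurableSet_Icc]
  exact tsum_congr fun j => sum_dirac_Icc (hy j) (hφ j) hA

theorem measurable_eigenanglePointMeasure_Icc (A : ℝ) :
    Measurable fun p : (ℕ → ℝ) × (ℕ → ℝ) => eigenanglePointMeasure p.1 p.2 (Icc 0 A) := by
  unfold eigenanglePointMeasure
  simp_rw [Measure.sum_apply _ measurableSet_Icc, Measure.dirac_apply' _ measurableSet_Icc]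
  refine Measurable.tsum fun j => Measurable.tsum fun k => ?_
  refine (measurable_one.indicator measurableSet_Icc).comp ?_
  fun_prop

theorem ae_mem_Ico_infinitePi :
    ∀ᵐ φ ∂Measure.infinitePi fun _ : ℕ => volume.restrict (Ico (0 : ℝ) 1),
      ∀ j, φ j ∈ Ico (0 : ℝ) 1 := by
  have := isProbabilityMeasure_restrict_Ico
  exact ae_all_iff.2 fun j => (measurePreserving_eval_infinitePi
    (fun _ : ℕ => volume.restrict (Ico (0 : ℝ) 1)) j).quasiMeasurePreserving.ae
      (ae_restrict_mem measurableSet_Ico)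

theorem lintegral_ofReal_add_centredCount {x : ℝ} (hx : 0 ≤ x) :
    ∫⁻ φ, ENNReal.ofReal (x + centredCount x φ) ∂volume.restrict (Ico (0 : ℝ) 1) =
      ENNReal.ofReal x := by
  have := isProbabilityMeasure_restrict_Ico
  have hi : Integrable (fun φ => x + centredCount x φ) (volume.restrict (Ico (0 : ℝ) 1)) :=
    (integrable_const x).add (integrable_centredCount x)
  rw [← ofReal_integral_eq_lintegral_ofReal hi,
    integral_add (integrable_const x) (integrable_centredCount x), integral_centredCount]
  · simp
  · filter_upwards [ae_restrict_mem measurableSet_Ico] with φ hφ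
      using add_centredCount_nonneg hx hφ

/-- For `A ≥ 0` the mean count over the phases is `∑' j, A * y j = A`, and a finite mean forces
almost sure finiteness. -/
theorem ae_eigenanglePointMeasure_Icc_lt_top {y : ℕ → ℝ} (hy : ∀ j, 0 < y j) (hsum : HasSum y 1)
    (A : ℝ) :
    ∀ᵐ φ ∂Measure.infinitePi fun _ : ℕ => volume.restrict (Ico (0 : ℝ) 1),
      eigenanglePointMeasure y φ (Icc 0 A) < ⊤ := by
  have := isProbabilityMeasure_restrict_Ico
  rcases lt_or_ge A 0 with hA | hA
  · simp [Icc_eq_empty_of_lt hA]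
  have hx (j) : 0 ≤ A * y j := mul_nonneg hA (hy j).le
  have hm (x : ℝ) : Measurable fun φ => ENNReal.ofReal (x + centredCount x φ) :=
    ((measurable_centredCount x).const_add x).ennreal_ofReal
  have hm' (j : ℕ) : Measurable fun φ : ℕ → ℝ =>
      ENNReal.ofReal (A * y j + centredCount (A * y j) (φ j)) :=
    (hm (A * y j)).comp (measurable_pi_apply j)
  have h : ∫⁻ φ, ∑' j, ENNReal.ofReal (A * y j + centredCount (A * y j) (φ j))
      ∂(Measure.infinitePi fun _ : ℕ => volume.restrict (Ico (0 : ℝ) 1)) ≠ ⊤ := by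
    rw [lintegral_tsum fun j => (hm' j).aemeasurable]
    have h1 (j : ℕ) := (measurePreserving_eval_infinitePi
      (fun _ : ℕ => volume.restrict (Ico (0 : ℝ) 1)) j).lintegral_comp (hm (A * y j))
    simp only [Function.eval] at h1
    simp_rw [h1, lintegral_ofReal_add_centredCount (hx _)]
    rw [← ENNReal.ofReal_tsum_of_nonneg hx (hsum.summable.mul_left A)]
    exact ENNReal.ofReal_ne_top
  filter_upwards [ae_lt_top (Measurable.tsum hm') h, ae_mem_Ico_infinitePi] with φ h1 h2
  rwa [eigenanglePointMeasure_Icc hy h2 hA]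

theorem hasSum_centredCount {y φ : ℕ → ℝ} (hy : ∀ j, 0 < y j) (hsum : HasSum y 1)
    (hφ : ∀ j, φ j ∈ Ico (0 : ℝ) 1) {A : ℝ} (hA : 0 ≤ A)
    (hfin : eigenanglePointMeasure y φ (Icc 0 A) < ⊤) :
    HasSum (fun j => centredCount (A * y j) (φ j))
      ((eigenanglePointMeasure y φ (Icc 0 A)).toReal - A) := by
  rw [eigenanglePointMeasure_Icc hy hφ hA] at hfin ⊢
  have h0 (j) := add_centredCount_nonneg (mul_nonneg hA (hy j).le) (hφ j)
  have h1 := ENNReal.hasSum_toReal hfin.ne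
  simp_rw [ENNReal.toReal_ofReal (h0 _)] at h1
  rw [ENNReal.tsum_toReal_eq fun _ => ENNReal.ofReal_ne_top]
  simp_rw [ENNReal.toReal_ofReal (h0 _)]
  have h2 := h1.sub (hsum.mul_left A)
  simpa using h2

theorem integral_exp_sum_centredCount (x : ℕ → ℝ) (s : ℝ) (J : ℕ) :
    ∫ φ, Complex.exp (s * (∑ j ∈ Finset.range J, centredCount (x j) (φ j) : ℝ) * Complex.I)
      ∂(Measure.infinitePi fun _ : ℕ => volume.restrict (Ico (0 : ℝ) 1)) =
    ∏ j ∈ Finset.range J, centredBernoulliCharFun (Int.fract (x j)) s := by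
  have := isProbabilityMeasure_restrict_Ico
  set ν := Measure.infinitePi fun _ : ℕ => volume.restrict (Ico (0 : ℝ) 1) with hν
  have hm (j : ℕ) : Measurable fun φ : ℕ → ℝ => centredCount (x j) (φ j) :=
    (measurable_centredCount (x j)).comp (measurable_pi_apply j)
  have hind : iIndepFun (fun (j : ℕ) (φ : ℕ → ℝ) => centredCount (x j) (φ j)) ν :=
    iIndepFun_infinitePi (X := fun j => centredCount (x j)) fun j => measurable_centredCount (x j)
  have h := congrFun (iIndepFun.charFun_map_fun_finsetSum_eq_prod (s := Finset.range J)
    (fun j _ => (hm j).aemeasurable) (hind.restrict _)) s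
  have hlhs := integral_map (μ := ν) (Finset.measurable_fun_sum (Finset.range J)
    fun j _ => hm j).aemeasurable (f := fun z : ℝ => Complex.exp (s * z * Complex.I))
    (Continuous.aestronglyMeasurable (by fun_prop))
  rw [charFun_apply_real, hlhs, Finset.prod_apply] at h
  rw [h]
  refine Finset.prod_congr rfl fun j _ => ?_
  have hmap : ν.map (fun φ : ℕ → ℝ => centredCount (x j) (φ j)) =
      (volume.restrict (Ico (0 : ℝ) 1)).map (centredCount (x j)) := by
    have := (measurePreserving_eval_infinitePi
      (fun _ : ℕ => volume.restrict (Ico (0 : ℝ) 1)) j).map_eq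
    conv_rhs => rw [← this, Measure.map_map (measurable_centredCount _) (measurable_pi_apply j)]
    rfl
  rw [hmap, charFun_apply_real, integral_map (measurable_centredCount _).aemeasurable
    (Continuous.aestronglyMeasurable (by fun_prop)), integral_exp_centredCount]

theorem norm_centredBernoulliCharFun_le_one {p : ℝ} (hp0 : 0 ≤ p) (hp1 : p ≤ 1) (s : ℝ) :
    ‖centredBernoulliCharFun p s‖ ≤ 1 := by
  refine (norm_add_le _ _).trans ?_
  rw [norm_mul, norm_mul, Complex.norm_exp_ofReal_mul_I, Complex.norm_exp_ofReal_mul_I,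
    ← Complex.ofReal_one, ← Complex.ofReal_sub, Complex.norm_real, Complex.norm_real,
    Real.norm_of_nonneg hp0, Real.norm_of_nonneg (by linarith)]
  linarith

/-- For the first `J` pieces, independence turns both terms into products, compared factor by
factor. The bound is uniform in `J`, so it passes to the limit. -/
theorem norm_integral_exp_sub_le {y : ℕ → ℝ} (hy : ∀ j, 0 < y j) (hsum : HasSum y 1) {A s : ℝ}
    (hA : 0 ≤ A) (hs : |s| ≤ 1) (hV : Summable fun j => fractVar (A * y j)) :
    ‖∫ φ, Complex.exp (s * ((eigenanglePointMeasure y φ (Icc 0 A)).toReal - A : ℝ) * Complex.I)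
        ∂(Measure.infinitePi fun _ : ℕ => volume.restrict (Ico (0 : ℝ) 1)) -
      Complex.exp ((-(s ^ 2 * (∑' j, fractVar (A * y j)) / 2) : ℝ))‖ ≤
      2 * |s| ^ 3 * ∑' j, fractVar (A * y j) := by
  have := isProbabilityMeasure_restrict_Ico
  set ν := Measure.infinitePi fun _ : ℕ => volume.restrict (Ico (0 : ℝ) 1) with hν
  have hm (J : ℕ) : Measurable fun φ : ℕ → ℝ =>
      ∑ j ∈ Finset.range J, centredCount (A * y j) (φ j) :=
    Finset.measurable_fun_sum _ fun j _ =>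
      (measurable_centredCount _).comp (measurable_pi_apply j)
  have hlim : Tendsto (fun J : ℕ => ∫ φ, Complex.exp
      (s * (∑ j ∈ Finset.range J, centredCount (A * y j) (φ j) : ℝ) * Complex.I) ∂ν) atTop
      (𝓝 (∫ φ, Complex.exp (s * ((eigenanglePointMeasure y φ (Icc 0 A)).toReal - A : ℝ) *
        Complex.I) ∂ν)) := by
    refine tendsto_integral_of_dominated_convergence (fun _ => 1) (fun J => ?_)
      (integrable_const _) (fun J => ae_of_all _ fun φ => ?_) ?_
    · have := hm J
      exact Measurable.aestronglyMeasurable (by fun_prop)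
    · rw [← Complex.ofReal_mul, Complex.norm_exp_ofReal_mul_I]
    · filter_upwards [ae_eigenanglePointMeasure_Icc_lt_top hy hsum A, ae_mem_Ico_infinitePi]
        with φ h1 h2
      have h3 := (hasSum_centredCount hy hsum h2 hA h1).tendsto_sum_nat
      have hc : Continuous fun z : ℝ => Complex.exp (s * z * Complex.I) := by fun_prop
      exact (hc.tendsto _).comp h3
  have hlim2 : Tendsto (fun J : ℕ => Complex.exp
      ((-(s ^ 2 * (∑ j ∈ Finset.range J, fractVar (A * y j)) / 2) : ℝ))) atTop
      (𝓝 (Complex.exp ((-(s ^ 2 * (∑' j, fractVar (A * y j)) / 2) : ℝ)))) := by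
    have hc : Continuous fun z : ℝ => Complex.exp ((-(s ^ 2 * z / 2) : ℝ)) := by fun_prop
    exact (hc.tendsto _).comp hV.hasSum.tendsto_sum_nat
  refine le_of_tendsto (hlim.sub hlim2).norm (Eventually.of_forall fun J => ?_)
  rw [integral_exp_sum_centredCount (fun j => A * y j)]
  have hexp : Complex.exp ((-(s ^ 2 * (∑ j ∈ Finset.range J, fractVar (A * y j)) / 2) : ℝ)) =
      ∏ j ∈ Finset.range J, Complex.exp ((-(s ^ 2 * fractVar (A * y j) / 2) : ℝ)) := by
    rw [← Complex.exp_sum, ← Complex.ofReal_sum, Finset.sum_neg_distrib, Finset.mul_sum,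
      Finset.sum_div]
  rw [hexp]
  refine (norm_prod_sub_prod_le_sum _ _ _ (fun j _ => ?_) fun j _ => ?_).trans ?_
  · exact norm_centredBernoulliCharFun_le_one (Int.fract_nonneg _) (Int.fract_lt_one _).le s
  · rw [← Complex.ofReal_exp, Complex.norm_real, Real.norm_of_nonneg (Real.exp_pos _).le,
      Real.exp_le_one_iff]
    have := fractVar_nonneg (A * y j)
    have : 0 ≤ s ^ 2 * fractVar (A * y j) / 2 := by positivity
    linarith
  · refine (Finset.sum_le_sum fun j _ => norm_centredBernoulliCharFun_sub_le
      (Int.fract_nonneg _) (Int.fract_lt_one (A * y j)).le hs).trans ?_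
    rw [← Finset.mul_sum]
    gcongr
    exact hV.sum_le_tsum _ fun j _ => fractVar_nonneg _

/-! ### From the conditional to the unconditional limit. -/

/-- Conditional characteristic function of the centred and rescaled number of points in `[0, A]`,
given the fractions of the stick. -/
noncomputable def condCharFun (θ t A : ℝ) (v : ℕ → ℝ) : ℂ :=
  ∫ φ, Complex.exp (t * (((eigenanglePointMeasure (stickBreaking v) φ (Icc 0 A)).toReal - A) /
    √(θ / 6 * Real.log A) : ℝ) * Complex.I)
    ∂(Measure.infinitePi fun _ : ℕ => volume.restrict (Ico (0 : ℝ) 1))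

theorem measurable_rescaledCount (θ A : ℝ) :
    Measurable fun p : (ℕ → ℝ) × (ℕ → ℝ) =>
      ((eigenanglePointMeasure p.1 p.2 (Icc 0 A)).toReal - A) / √(θ / 6 * Real.log A) :=
  ((measurable_eigenanglePointMeasure_Icc A).ennreal_toReal.sub_const A).div_const _

theorem stronglyMeasurable_condCharFun (θ t A : ℝ) :
    StronglyMeasurable (condCharFun θ t A) := by
  have := isProbabilityMeasure_restrict_Ico
  have h := (measurable_rescaledCount θ A).comp
    ((measurable_stickBreaking.comp measurable_fst).prodMk measurable_snd :
      Measurable fun p : (ℕ → ℝ) × (ℕ → ℝ) => (stickBreaking p.1, p.2))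
  refine StronglyMeasurable.integral_prod_right' (f := fun p : (ℕ → ℝ) × (ℕ → ℝ) => Complex.exp
    (t * (((eigenanglePointMeasure (stickBreaking p.1) p.2 (Icc 0 A)).toReal - A) /
    √(θ / 6 * Real.log A) : ℝ) * Complex.I)) (Measurable.stronglyMeasurable ?_)
  simp only [Function.comp_def] at h
  fun_prop

theorem norm_condCharFun_le_one (θ t A : ℝ) (v : ℕ → ℝ) : ‖condCharFun θ t A v‖ ≤ 1 := by
  have := isProbabilityMeasure_restrict_Ico
  refine (norm_integral_le_of_norm_le_const (C := 1) (ae_of_all _ fun φ => ?_)).trans (by simp)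
  rw [← Complex.ofReal_mul, Complex.norm_exp_ofReal_mul_I]

/-- Rescaling evaluates the comparison at `s = t / σ`. There `s ^ 2 * V` tends to `t ^ 2`, and the
error `2 * |s| * (s ^ 2 * V)` vanishes because `s` does. -/
theorem IsRegularFractions.tendsto_condCharFun {θ : ℝ} {v : ℕ → ℝ} (hv : IsRegularFractions θ v)
    (hθ : 0 < θ) (t : ℝ) {A : ℕ → ℝ} (hA : Tendsto A atTop atTop)
    (hV : Tendsto (fun k => stickVar (A k) v / Real.log (A k)) atTop (𝓝 (θ / 6))) :
    Tendsto (fun k => condCharFun θ t (A k) v) atTop (𝓝 (Complex.exp ((-(t ^ 2 / 2) : ℝ)))) := by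
  have hL := Real.tendsto_log_atTop.comp hA
  set σ : ℕ → ℝ := fun k => √(θ / 6 * Real.log (A k)) with hσ
  have hσtop : Tendsto σ atTop atTop :=
    Real.tendsto_sqrt_atTop.comp (hL.const_mul_atTop (by positivity))
  set s : ℕ → ℝ := fun k => t / σ k with hs
  have hs0 : Tendsto s atTop (𝓝 0) := hσtop.const_div_atTop t
  have hsV : Tendsto (fun k => s k ^ 2 * stickVar (A k) v) atTop (𝓝 (t ^ 2)) := by
    have h := (hV.mul_const (t ^ 2 * (6 / θ)))
    rw [show θ / 6 * (t ^ 2 * (6 / θ)) = t ^ 2 by field_simp] at h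
    refine h.congr' ?_
    filter_upwards [hL.eventually_gt_atTop 0] with k hk
    simp only [Function.comp_apply] at hk
    have h2 : σ k ^ 2 = θ / 6 * Real.log (A k) := Real.sq_sqrt (by positivity)
    simp only [hs, div_pow, h2]
    field_simp
  have herr : Tendsto (fun k => 2 * |s k| ^ 3 * stickVar (A k) v) atTop (𝓝 0) := by
    have h := (hs0.abs.const_mul 2).mul hsV
    rw [abs_zero, mul_zero, zero_mul] at h
    refine h.congr fun k => ?_
    rw [← sq_abs]
    ring
  have hmain : Tendsto (fun k => Complex.exp ((-(s k ^ 2 * stickVar (A k) v / 2) : ℝ))) atTop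
      (𝓝 (Complex.exp ((-(t ^ 2 / 2) : ℝ)))) := by
    have hc : Continuous fun z : ℝ => Complex.exp ((-(z / 2) : ℝ)) := by fun_prop
    exact (hc.tendsto _).comp hsV
  have hdiff : Tendsto (fun k => condCharFun θ t (A k) v -
      Complex.exp ((-(s k ^ 2 * stickVar (A k) v / 2) : ℝ))) atTop (𝓝 0) := by
    refine squeeze_zero_norm' ?_ herr
    filter_upwards [hA.eventually_ge_atTop 0, hs0.abs.eventually_le_const (u := 1) (by simp)]
      with k hAk hsk
    have h := norm_integral_exp_sub_le hv.stickBreaking_pos (hv.hasSum_stickBreaking hθ) hAk hsk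
      (hv.summable_fractVar hθ hAk)
    have hcond : condCharFun θ t (A k) v = ∫ φ, Complex.exp (s k *
        ((eigenanglePointMeasure (stickBreaking v) φ (Icc 0 (A k))).toReal - A k : ℝ) * Complex.I)
        ∂(Measure.infinitePi fun _ : ℕ => volume.restrict (Ico (0 : ℝ) 1)) := by
      unfold condCharFun
      congr 1
      ext φ
      congr 2
      rw [← Complex.ofReal_mul, ← Complex.ofReal_mul]
      congr 1
      simp only [hs, hσ]
      ring
    rw [hcond]
    exact h
  simpa using hdiff.add hmain

/-- The conditional variance is controlled almost surely only along subsequences. This suffices,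
since a limit of numbers may be tested on subsequences of arbitrary sequences. -/
theorem tendsto_integral_condCharFun {θ : ℝ} (hθ : 0 < θ) (t : ℝ) :
    Tendsto (fun A : ℝ => ∫ v, condCharFun θ t A v
      ∂(Measure.infinitePi fun _ : ℕ => betaMeasure 1 θ)) atTop
      (𝓝 (Complex.exp ((-(t ^ 2 / 2) : ℝ)))) := by
  have hp : IsProbabilityMeasure (betaMeasure 1 θ) := isProbabilityMeasureBeta one_pos hθ
  refine tendsto_of_subseq_tendsto fun A hA => ?_
  obtain ⟨ns, hns, hV⟩ := exists_seq_tendsto_stickVar hθ hA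
  refine ⟨ns, ?_⟩
  have h := tendsto_integral_of_dominated_convergence
    (μ := Measure.infinitePi fun _ : ℕ => betaMeasure 1 θ)
    (F := fun k v => condCharFun θ t (A (ns k)) v)
    (f := fun _ => Complex.exp ((-(t ^ 2 / 2) : ℝ))) (fun _ => 1)
    (fun k => (stronglyMeasurable_condCharFun θ t _).aestronglyMeasurable) (integrable_const _)
    (fun k => ae_of_all _ fun v => norm_condCharFun_le_one θ t _ v) ?_
  · simpa using h
  · filter_upwards [hV, ae_isRegularFractions hθ] with v h1 h2
    exact h2.tendsto_condCharFun hθ t (hA.comp hns.tendsto_atTop) h1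

theorem charFun_map_rescaledCount {θ : ℝ} (hθ : 0 < θ) (A t : ℝ) :
    charFun (((gemMeasure θ).prod (Measure.infinitePi fun _ : ℕ =>
        volume.restrict (Ico (0 : ℝ) 1))).map fun p =>
      ((eigenanglePointMeasure p.1 p.2 (Icc 0 A)).toReal - A) / √(θ / 6 * Real.log A)) t =
    ∫ v, condCharFun θ t A v ∂(Measure.infinitePi fun _ : ℕ => betaMeasure 1 θ) := by
  have hp : IsProbabilityMeasure (betaMeasure 1 θ) := isProbabilityMeasureBeta one_pos hθ
  have := isProbabilityMeasure_restrict_Ico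
  have := isProbabilityMeasure_gemMeasure hθ
  have hm := measurable_rescaledCount θ A
  have hme : Measurable fun p : (ℕ → ℝ) × (ℕ → ℝ) => Complex.exp
      (t * (((eigenanglePointMeasure p.1 p.2 (Icc 0 A)).toReal - A) /
        √(θ / 6 * Real.log A) : ℝ) * Complex.I) := by fun_prop
  rw [charFun_apply_real, integral_map hm.aemeasurable
    (Continuous.aestronglyMeasurable (by fun_prop)), integral_prod]
  · rw [gemMeasure, integral_map measurable_stickBreaking.aemeasurable]
    · rfl
    · exact hme.stronglyMeasurable.integral_prod_right'.aestronglyMeasurable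
  · refine Integrable.of_bound hme.aestronglyMeasurable 1 (ae_of_all _ fun p => ?_)
    rw [← Complex.ofReal_mul, Complex.norm_exp_ofReal_mul_I]

theorem ae_prod_eigenanglePointMeasure_Icc_lt_top {θ : ℝ} (hθ : 0 < θ) :
    ∀ᵐ p ∂(gemMeasure θ).prod (Measure.infinitePi fun _ : ℕ => volume.restrict (Ico (0 : ℝ) 1)),
      ∀ A : ℝ, eigenanglePointMeasure p.1 p.2 (Icc 0 A) < ⊤ := by
  have hp : IsProbabilityMeasure (betaMeasure 1 θ) := isProbabilityMeasureBeta one_pos hθ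
  have := isProbabilityMeasure_restrict_Ico
  have := isProbabilityMeasure_gemMeasure hθ
  -- The count is monotone in `A`, so integer endpoints suffice and the exceptional sets are
  -- countably many.
  have hnat : ∀ᵐ p ∂(gemMeasure θ).prod
      (Measure.infinitePi fun _ : ℕ => volume.restrict (Ico (0 : ℝ) 1)),
      ∀ n : ℕ, eigenanglePointMeasure p.1 p.2 (Icc 0 n) < ⊤ := by
    refine ae_all_iff.2 fun n => ?_
    have hms : MeasurableSet {p : (ℕ → ℝ) × (ℕ → ℝ) |
        eigenanglePointMeasure p.1 p.2 (Icc 0 n) < ⊤} :=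
      measurableSet_lt (measurable_eigenanglePointMeasure_Icc n) measurable_const
    -- Regularity is known for the fractions rather than the pieces, so the law is pulled back
    -- through `stickBreaking`.
    have hgem : (gemMeasure θ).prod
        (Measure.infinitePi fun _ : ℕ => volume.restrict (Ico (0 : ℝ) 1)) =
        ((Measure.infinitePi fun _ : ℕ => betaMeasure 1 θ).prod
          (Measure.infinitePi fun _ : ℕ => volume.restrict (Ico (0 : ℝ) 1))).map
            (Prod.map stickBreaking id) := by
      rw [← Measure.map_prod_map _ _ measurable_stickBreaking measurable_id, Measure.map_id]
      rfl
    have hm : Measurable (Prod.map stickBreaking (id : (ℕ → ℝ) → ℕ → ℝ)) :=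
      measurable_stickBreaking.prodMap measurable_id
    rw [hgem]
    refine (ae_map_iff hm.aemeasurable hms).2 ((Measure.ae_prod_iff_ae_ae (hm hms)).2 ?_)
    filter_upwards [ae_isRegularFractions hθ] with v hv
    exact ae_eigenanglePointMeasure_Icc_lt_top hv.stickBreaking_pos (hv.hasSum_stickBreaking hθ) n
  filter_upwards [hnat] with p hp A
  obtain ⟨n, hn⟩ := exists_nat_ge A
  exact (measure_mono (Icc_subset_Icc_right hn)).trans_lt (hp n)

theorem mainTheorem1 {Ω : Type*} [MeasurableSpace Ω] (P : Measure Ω) [IsProbabilityMeasure P]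
    (θ : ℝ) (hθ : 0 < θ) (y Φ : ℕ → Ω → ℝ)
    (hy : HasLaw (fun ω j => y j ω) (gemMeasure θ) P)
    (hΦ : ∀ j, HasLaw (Φ j) (volume.restrict (Ico (0 : ℝ) 1)) P)
    (hΦ_indep : iIndepFun Φ P)
    (hyΦ : IndepFun (fun ω j => y j ω) (fun ω j => Φ j ω) P) :
    (∀ᵐ ω ∂P, ∀ A : ℝ,
      eigenanglePointMeasure (fun j => y j ω) (fun j => Φ j ω) (Icc 0 A) < ⊤) ∧
    TendstoInDistribution
      (fun (A : ℝ) (ω : Ω) =>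
        ((eigenanglePointMeasure (fun j => y j ω) (fun j => Φ j ω) (Icc 0 A)).toReal - A)
          / √(θ / 6 * Real.log A))
      atTop (id : ℝ → ℝ) (fun _ => P) (gaussianReal 0 1) := by
  have := isProbabilityMeasure_restrict_Ico
  have := isProbabilityMeasure_gemMeasure hθ
  have hΦlaw : HasLaw (fun ω j => Φ j ω)
      (Measure.infinitePi fun _ : ℕ => volume.restrict (Ico (0 : ℝ) 1)) P :=
    hΦ_indep.hasLaw_infinitePi hΦ (aemeasurable_pi_lambda _ fun j => (hΦ j).aemeasurable)
  have hjoint : AEMeasurable (fun ω => ((fun j => y j ω), fun j => Φ j ω)) P :=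
    hy.aemeasurable.prodMk hΦlaw.aemeasurable
  have hmap : P.map (fun ω => ((fun j => y j ω), fun j => Φ j ω)) =
      (gemMeasure θ).prod (Measure.infinitePi fun _ : ℕ => volume.restrict (Ico (0 : ℝ) 1)) := by
    rw [(indepFun_iff_map_prod_eq_prod_map_map hy.aemeasurable hΦlaw.aemeasurable).1 hyΦ,
      hy.map_eq, hΦlaw.map_eq]
  constructor
  · have h := ae_prod_eigenanglePointMeasure_Icc_lt_top hθ
    rw [← hmap] at h
    exact ae_of_ae_map hjoint h
  · have hmeas (A : ℝ) : AEMeasurable (fun ω : Ω =>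
        ((eigenanglePointMeasure (fun j => y j ω) (fun j => Φ j ω) (Icc 0 A)).toReal - A)
          / √(θ / 6 * Real.log A)) P := by
      have h := (measurable_rescaledCount θ A).comp_aemeasurable hjoint
      simpa only [Function.comp_def] using h
    refine ⟨hmeas, aemeasurable_id, ?_⟩
    -- Lévy's continuity theorem is applied along an arbitrary sequence `A k` tending to infinity.
    refine tendsto_of_seq_tendsto fun A hA => ?_
    refine ProbabilityMeasure.tendsto_of_tendsto_charFun fun t => ?_
    have h := (tendsto_integral_condCharFun hθ t).comp hA
    have hlim : charFun ((gaussianReal 0 1).map (id : ℝ → ℝ)) t =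
        Complex.exp ((-(t ^ 2 / 2) : ℝ)) := by
      rw [Measure.map_id, charFun_gaussianReal]
      congr 1
      push_cast
      ring
    simp only [ProbabilityMeasure.coe_mk, Function.comp_def] at h ⊢
    rw [hlim]
    refine h.congr fun k => ?_
    rw [← charFun_map_rescaledCount hθ, ← hmap,
      AEMeasurable.map_map_of_aemeasurable (measurable_rescaledCount θ (A k)).aemeasurable hjoint]
    rfl
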